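/- Let $k$ be an algebraically closed field of characteristic zero, $g\ge 2$ an integer with $g\neq 2,3,6$, and let $\mathcal X_g$ be a hyperelliptic curve of genus $g$ over $k$, given by $Y^2=F(X)$ with $F\in k[X]$ squarefree of degree $2g+2$, with function field $K=k(X,Y)$. Let $\operatorname{Aut}(\mathcal X_g)=\operatorname{Aut}(K/k)$, and suppose that the reduced automorphism group $\overline{\operatorname{Aut}}(\mathcal X_g)=\operatorname{Aut}(K/k)/\operatorname{Gal}(K/k(X))$ is isomorphic to $A_4$. Let $\mathcal W\subset\mathbb P^1$ be the set of images of the Weierstrass points of $\mathcal X_g$, i.e. the set of places of $k(X)$ that ramify in $K$. Let $\phi:\mathbb P^1\to\mathbb P^1/\overline{\operatorname{Aut}}(\mathcal X_g)\cong\mathbb P^1$ be the quotient map, and let $V=\bigcup_{q}\phi^{-1}(q)$, the union being over the branch points $q$ of $\phi$. Then the following hold. (i) If $|V\cap\mathcal W|=0$, $4$, $8$, then $\operatorname{Aut}(\mathcal X_g)\cong \mathbb Z_2\oplus A_4$ and $g\equiv -1$, $1$, $3 \pmod 6$, respectively. (ii) If $|V\cap\mathcal W|=6$, $10$, $14$,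 then $\operatorname{Aut}(\mathcal X_g)\cong SL_2(3)=SL_2(\mathbb F_3)$ and $g\equiv 2$, $4$, $0 \pmod 6$, respectively. -/

import Mathlib

/-- A place of the function field `L/k`: a proper valuation ring of `L` containing `k`. -/
@[ext]
structure Place (k L : Type*) [Field k] [Field L] [Algebra k L] where
  ring : ValuationSubring L
  algebraMap_mem : ∀ c : k, algebraMap k L c ∈ ring
  ne_top : ring ≠ ⊤

namespace Place

variable {k L : Type*} [Field k] [Field L] [Algebra k L]

/-- The place `P` of `L` lies over the place `p` of `E`, that is, `O_P ∩ E = O_p`; in other words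
`p` is the image of `P` under the covering of curves given by `L/E`. -/
def LiesOver {E : Type*} [Field E] [Algebra k E] [Algebra E L] (P : Place k L) (p : Place k E) :
    Prop :=
  P.ring.comap (algebraMap E L) = p.ring

/-- The ramification index `e = (v(Lˣ) : v(Eˣ))` of `P` in `L/E`, with `v` the valuation of `P`
(the whole group of nonzero values is `v(Lˣ)`). -/
noncomputable def ramificationIndex (E : Type*) [Field E] [Algebra E L] (P : Place k L) : ℕ :=
  (Units.map ((P.ring.valuation.comap (algebraMap E L)).toMonoidWithZeroHom :
    E →* P.ring.ValueGroup)).range.index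

/-- `P` is ramified in `L/E`. -/
def IsRamified (E : Type*) [Field E] [Algebra E L] (P : Place k L) : Prop :=
  P.ramificationIndex E ≠ 1

end Place

/-- The branch points of the covering given by `L/E`: the places of `E` over which some place of
`L` is ramified. -/
def branchPlaces (k E L : Type*) [Field k] [Field E] [Field L] [Algebra k E] [Algebra k L]
    [Algebra E L] : Set (Place k E) :=
  {p | ∃ P : Place k L, P.LiesOver p ∧ P.IsRamified E}

/-- `K/k` is the function field of the hyperelliptic curve `Y ^ 2 = F(X)` of genus `g ≥ 2`,
with `F` of degree `2g + 2` without multiple roots; `x` and `y` are the coordinate functions. -/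
structure IsHyperelliptic (k K : Type*) [Field k] [Field K] [Algebra k K] (g : ℕ)
    (F : Polynomial k) (x y : K) : Prop where
  two_le_genus : 2 ≤ g
  natDegree_eq : F.natDegree = 2 * g + 2
  squarefree : Squarefree F
  transcendental : Transcendental k x
  equation : y ^ 2 = Polynomial.aeval x F
  adjoin_eq_top : IntermediateField.adjoin k {x, y} = ⊤

namespace Hyperelliptic

variable (k : Type*) {K : Type*} [Field k] [Field K] [Algebra k K] (x : K)

/-- The subfield `k(X)` of `K`, the function field of the projective line. -/
noncomputable abbrev lineField : IntermediateField k K :=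
  IntermediateField.adjoin k {x}

/-- The group `Gal(K / k(X))`, generated by the hyperelliptic involution. -/
noncomputable def involutionSubgroup : Subgroup (K ≃ₐ[k] K) :=
  (lineField k x).fixingSubgroup

/-- The reduced automorphism group: the quotient of `Aut(K/k)` by `Gal(K / k(X))`. The latter is
a normal subgroup when the genus is at least two, so it is its own normal closure; the normal
closure is written so that the quotient is a group by construction. -/
abbrev ReducedAut : Type _ :=
  (K ≃ₐ[k] K) ⧸ Subgroup.normalClosure (involutionSubgroup k x : Set (K ≃ₐ[k] K))

/-- The field of elements of `k(X)` fixed by all of `Aut(K/k)`: the function field of the quotient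
of the projective line by the reduced automorphism group. The quotient covering `φ` corresponds to
the extension of this field by `k(X)`. -/
noncomputable abbrev quotientField : IntermediateField k (lineField k x) :=
  (IntermediateField.fixedField (⊤ : Subgroup (K ≃ₐ[k] K))).comap (lineField k x).val

/-- The set `𝒲` of images on the projective line of the Weierstrass points: the places of `k(X)`
that ramify in `K`. -/
def weierstrassImages : Set (Place k (lineField k x)) :=
  branchPlaces k (lineField k x) K

/-- The set `V = ⋃ φ⁻¹(q)`, the union over the branch points `q` of the covering `φ`. -/
def branchFibers : Set (Place k (lineField k x)) :=
  {p | ∃ q ∈ branchPlaces k (quotientField k x) (lineField k x), p.LiesOver q}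

end Hyperelliptic

/-! ### Coordinates and places of a rational function field -/

section

open Polynomial IntermediateField

/-! Every automorphism preserves `k(x)`, so the reduced group is a group `G ≅ A₄` of automorphisms
of the line, and `Aut(K/k)` is a double cover of it. To see this, suppose that `u = σ x` lies
outside `k(x)`. Then `x` and `u` satisfy a relation of degree at most 2 in each variable, and its
discriminant, of degree at most 4 in `x`, equals `F` times a square. This is absurd, since `F` has
at least six simple roots.

In the covering of the line by the curve, the ramified places `𝒲` are those where `F(x)` has odd
order; there are `2g + 2` of them. In the covering `φ`, ramification means nontrivial stabilizer in
`G`, so `V` is the set of places with nontrivial stabilizer. As `G` acts freely off `V`, `2g + 2 ≡ n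
(mod 12)` for `n = |V ∩ 𝒲|`, which gives all the congruences.

If `σ` lifts an involution `s` of the line fixing `p`, then `σ y = c y` with `s F(x) = c² F(x)`, and
`s(c) c = ±1`. Evaluating at `p`, where `s` acts on the cotangent line by `-1`, gives the sign
`(-1)^(ord_p F(x))`. Thus `σ` has order four exactly when `p ∈ 𝒲`. The three involutions of `A₄` are
conjugate, so their lifts all behave alike, and their `3 · 2 = 6` distinct fixed places lie all in
`𝒲` or all outside. The Klein four-group acts freely on the rest of `V ∩ 𝒲`, so `n` is 0 or 2 modulo
4, and `n` tells which case occurs.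

Finally, a double cover of `A₄` is determined by the orders of the lifts of the Klein four-group (a
transfer argument on a fibre product). The two cases are `ℤ₂ × A₄` and `SL₂(𝔽₃)`. -/

/-- A transcendental generator of `L` over `k`. -/
structure IsCoordinate (k : Type*) {L : Type*} [Field k] [Field L] [Algebra k L] (t : L) :
    Prop where
  transcendental : Transcendental k t
  adjoin_eq_top : k⟮t⟯ = ⊤

namespace IsCoordinate

variable {k L : Type*} [Field k] [Field L] [Algebra k L] {t : L}

theorem ne_zero (ht : IsCoordinate k t) : t ≠ 0 := by
  rintro rfl
  exact ht.transcendental isAlgebraic_zero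

theorem aeval_ne_zero (ht : IsCoordinate k t) {P : k[X]} (hP : P ≠ 0) : aeval t P ≠ 0 :=
  fun h => hP (transcendental_iff.1 ht.transcendental P h)

theorem exists_eq_div (ht : IsCoordinate k t) (f : L) :
    ∃ P Q : k[X], Q ≠ 0 ∧ f = aeval t P / aeval t Q := by
  have hf : f ∈ k⟮t⟯ := by rw [ht.adjoin_eq_top]; trivial
  obtain ⟨P, Q, h⟩ := (IntermediateField.mem_adjoin_simple_iff k f).1 hf
  rcases eq_or_ne Q 0 with rfl | hQ
  · exact ⟨0, 1, one_ne_zero, by simpa using h⟩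
  · exact ⟨P, Q, hQ, h⟩

theorem exists_isCoprime (ht : IsCoordinate k t) (f : L) :
    ∃ P Q : k[X], Q ≠ 0 ∧ IsCoprime P Q ∧ f = aeval t P / aeval t Q := by
  obtain ⟨P, Q, hQ, h⟩ := ht.exists_eq_div f
  obtain ⟨Q', P', c, hr, rfl, rfl⟩ := UniqueFactorizationMonoid.exists_reduced_factors Q hQ P
  have hc := left_ne_zero_of_mul hQ
  refine ⟨P', Q', right_ne_zero_of_mul hQ, hr.isCoprime.symm, ?_⟩
  rw [h, map_mul, map_mul, mul_div_mul_left _ _ (ht.aeval_ne_zero hc)]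

theorem of_mem (ht : IsCoordinate k t) {u : L} (h : t ∈ k⟮u⟯) : IsCoordinate k u := by
  have htop : k⟮u⟯ = ⊤ := by
    rw [eq_top_iff, ← ht.adjoin_eq_top]
    exact adjoin_simple_le_iff.2 h
  refine ⟨fun hu => ht.transcendental ?_, htop⟩
  have := isAlgebraic_adjoin_simple hu.isIntegral
  have h1 := this.isAlgebraic ⟨t, h⟩
  exact (isAlgebraic_algebraMap_iff (algebraMap k⟮u⟯ L).injective).2 h1

theorem inv (ht : IsCoordinate k t) : IsCoordinate k t⁻¹ :=
  ht.of_mem (by simpa using inv_mem (mem_adjoin_simple_self k t⁻¹))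

theorem sub_algebraMap (ht : IsCoordinate k t) (c : k) : IsCoordinate k (t - algebraMap k L c) :=
  ht.of_mem (by
    simpa using add_mem (mem_adjoin_simple_self k (t - algebraMap k L c))
      (IntermediateField.algebraMap_mem k⟮t - algebraMap k L c⟯ c))

theorem algebraMap_mul (ht : IsCoordinate k t) {c : k} (hc : c ≠ 0) :
    IsCoordinate k (algebraMap k L c * t) :=
  ht.of_mem (by
    have h := mul_mem (IntermediateField.algebraMap_mem k⟮algebraMap k L c * t⟯ c⁻¹)
      (mem_adjoin_simple_self k (algebraMap k L c * t))
    rwa [map_inv₀, inv_mul_cancel_left₀ (by simpa using hc)] at h)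

theorem map (ht : IsCoordinate k t) (g : L ≃ₐ[k] L) : IsCoordinate k (g t) := by
  refine ⟨fun h => ht.transcendental ?_, ?_⟩
  · simpa using (isAlgebraic_algHom_iff g.toAlgHom g.injective).1 h
  · have := congr_arg (IntermediateField.map g.toAlgHom) ht.adjoin_eq_top
    rw [adjoin_map] at this
    rw [Set.image_singleton, ← AlgHom.fieldRange_eq_map,
      AlgHom.fieldRange_eq_top.2 (show Function.Surjective g.toAlgHom from g.surjective)] at this
    exact this

theorem algEquiv_ext (ht : IsCoordinate k t) {g h : L ≃ₐ[k] L} (hgh : g t = h t) : g = h := by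
  ext f
  obtain ⟨P, Q, -, rfl⟩ := ht.exists_eq_div f
  rw [map_div₀, map_div₀]
  simp only [← aeval_algHom_apply, hgh]

end IsCoordinate

namespace Place

section Basic

variable {k L : Type*} [Field k] [Field L] [Algebra k L]

/-- The valuation of a place. -/
noncomputable abbrev val (p : Place k L) : Valuation L p.ring.ValueGroup := p.ring.valuation

theorem val_le_one_iff (p : Place k L) (f : L) : p.val f ≤ 1 ↔ f ∈ p.ring :=
  p.ring.valuation_le_one_iff f

theorem val_algebraMap (p : Place k L) {c : k} (hc : c ≠ 0) : p.val (algebraMap k L c) = 1 := by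
  apply le_antisymm ((p.val_le_one_iff _).2 (p.algebraMap_mem c))
  have h := (p.val_le_one_iff _).2 (p.algebraMap_mem c⁻¹)
  rw [map_inv₀, map_inv₀] at h
  exact (inv_le_one₀ (by simpa [zero_lt_iff] using hc)).1 h

theorem val_algebraMap_le (p : Place k L) (c : k) : p.val (algebraMap k L c) ≤ 1 :=
  (p.val_le_one_iff _).2 (p.algebraMap_mem c)

theorem val_algebraMap_lt_one_iff (p : Place k L) {c : k} :
    p.val (algebraMap k L c) < 1 ↔ c = 0 := by
  refine ⟨fun h => ?_, by rintro rfl; simp⟩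
  by_contra hc
  exact h.ne (p.val_algebraMap hc)

theorem val_aeval_le_one (p : Place k L) {f : L} (hf : p.val f ≤ 1) (P : k[X]) :
    p.val (aeval f P) ≤ 1 := by
  rw [aeval_eq_sum_range]
  refine Valuation.map_sum_le _ fun i _ => ?_
  rw [Algebra.smul_def, map_mul, map_pow]
  exact mul_le_one' (p.val_algebraMap_le _) (pow_le_one' hf _)

theorem val_aeval_sub_lt_one (p : Place k L) {f : L} (hf : p.val f < 1) (P : k[X]) :
    p.val (aeval f P - algebraMap k L (P.coeff 0)) < 1 := by
  have h := congr_arg (aeval f) P.divX_mul_X_add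
  simp only [map_add, map_mul, aeval_X, aeval_C] at h
  rw [← h, add_sub_cancel_right]
  exact mul_lt_one_of_nonneg_of_lt_one_right (p.val_aeval_le_one hf.le _) zero_le hf

theorem val_eq_one_of_sub_lt (p : Place k L) {f : L} {c : k} (hc : c ≠ 0)
    (h : p.val (f - algebraMap k L c) < 1) : p.val f = 1 := by
  rw [← p.val_algebraMap hc] at h ⊢
  exact Valuation.map_eq_of_sub_lt _ h

theorem val_aeval_eq_one (p : Place k L) {f : L} (hf : p.val f < 1) {P : k[X]}
    (hP : P.coeff 0 ≠ 0) : p.val (aeval f P) = 1 :=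
  p.val_eq_one_of_sub_lt hP (p.val_aeval_sub_lt_one hf P)

/-- Splitting off the powers of `X` leaves nonzero constant terms, hence a unit at every zero of
`t`: this makes `t` a uniformizer there. -/
theorem _root_.IsCoordinate.exists_zpow_mul {t : L} (ht : IsCoordinate k t) {f : L}
    (hf : f ≠ 0) : ∃ (n : ℤ) (P Q : k[X]), P.coeff 0 ≠ 0 ∧ Q.coeff 0 ≠ 0 ∧
      f = t ^ n * (aeval t P / aeval t Q) := by
  obtain ⟨P, Q, hQ, h⟩ := ht.exists_eq_div f
  have hP : P ≠ 0 := by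
    rintro rfl
    exact hf (by simpa using h)
  obtain ⟨P', hP', hP''⟩ := exists_eq_pow_rootMultiplicity_mul_and_not_dvd P hP 0
  obtain ⟨Q', hQ', hQ''⟩ := exists_eq_pow_rootMultiplicity_mul_and_not_dvd Q hQ 0
  rw [C_0, sub_zero] at hP' hQ' hP'' hQ''
  rw [X_dvd_iff] at hP'' hQ''
  refine ⟨(P.rootMultiplicity 0 : ℤ) - Q.rootMultiplicity 0, P', Q', hP'', hQ'', ?_⟩
  have h0 := ht.ne_zero
  have hPt := congr_arg (aeval t) hP'
  have hQt := congr_arg (aeval t) hQ'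
  rw [map_mul, map_pow, aeval_X] at hPt hQt
  rw [h, hPt, hQt, zpow_sub₀ h0, zpow_natCast, zpow_natCast, mul_div_mul_comm]

theorem val_zpow_mul (p : Place k L) {t : L} (hpt : p.val t < 1) {P Q : k[X]}
    (hP : P.coeff 0 ≠ 0) (hQ : Q.coeff 0 ≠ 0) (n : ℤ) :
    p.val (t ^ n * (aeval t P / aeval t Q)) = p.val t ^ n := by
  rw [map_mul, map_div₀, p.val_aeval_eq_one hpt hP, p.val_aeval_eq_one hpt hQ, map_zpow₀]
  simp

theorem exists_val_eq_zpow (p : Place k L) {t : L} (ht : IsCoordinate k t) (hpt : p.val t < 1)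
    {f : L} (hf : f ≠ 0) : ∃ n : ℤ, p.val f = p.val t ^ n := by
  obtain ⟨n, P, Q, hP, hQ, rfl⟩ := ht.exists_zpow_mul hf
  exact ⟨n, p.val_zpow_mul hpt hP hQ n⟩

theorem val_pos_of_isCoordinate (p : Place k L) {t : L} (ht : IsCoordinate k t) : 0 < p.val t := by
  simpa [zero_lt_iff] using ht.ne_zero

theorem zpow_le_one_iff (p : Place k L) {t : L} (ht : IsCoordinate k t) (hpt : p.val t < 1)
    {n : ℤ} : p.val t ^ n ≤ 1 ↔ 0 ≤ n := by
  rw [← zpow_zero (p.val t), zpow_le_zpow_iff_right_of_lt_one₀ (p.val_pos_of_isCoordinate ht) hpt]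

/-- A place of a rational function field is determined by the vanishing of one coordinate. -/
theorem eq_of_isCoordinate {p q : Place k L} {t : L} (ht : IsCoordinate k t)
    (hp : p.val t < 1) (hq : q.val t < 1) : p = q := by
  ext f
  rw [← p.val_le_one_iff, ← q.val_le_one_iff]
  rcases eq_or_ne f 0 with rfl | hf
  · simp
  obtain ⟨n, P, Q, hP, hQ, rfl⟩ := ht.exists_zpow_mul hf
  rw [p.val_zpow_mul hp hP hQ, q.val_zpow_mul hq hP hQ, p.zpow_le_one_iff ht hp,
    q.zpow_le_one_iff ht hq]

/-- All coordinates vanishing at a place have the same value there. -/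
theorem val_eq_val_of_isCoordinate (p : Place k L) {t u : L} (ht : IsCoordinate k t)
    (hu : IsCoordinate k u) (hpt : p.val t < 1) (hpu : p.val u < 1) : p.val t = p.val u := by
  obtain ⟨a, ha⟩ := p.exists_val_eq_zpow ht hpt hu.ne_zero
  obtain ⟨b, hb⟩ := p.exists_val_eq_zpow hu hpu ht.ne_zero
  have hab : a * b = 1 := by
    have h : p.val t ^ (a * b) = p.val t ^ (1 : ℤ) := by rw [zpow_mul, ← ha, ← hb, zpow_one]
    exact zpow_right_injective₀ (p.val_pos_of_isCoordinate ht) hpt.ne h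
  have ha0 : 0 ≤ a := (p.zpow_le_one_iff ht hpt).1 (ha ▸ hpu.le)
  obtain rfl : a = 1 := by
    rcases Int.eq_one_or_neg_one_of_mul_eq_one hab with h | h <;> omega
  simpa using ha.symm

/-- Since `t` is not a unit in `k[t]`, some valuation ring containing `k[t]` has `t` among its
nonunits. -/
theorem exists_val_lt_one {t : L} (ht : IsCoordinate k t) : ∃ p : Place k L, p.val t < 1 := by
  set A : Subalgebra k L := Algebra.adjoin k {t}
  have htA : t ∈ A := Algebra.self_mem_adjoin_singleton k t
  have hI : (Ideal.span {(⟨t, htA⟩ : A.toSubring)}) ≠ ⊤ := by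
    rw [Ne, Ideal.span_singleton_eq_top, isUnit_iff_exists_inv]
    rintro ⟨⟨b, hb⟩, hb'⟩
    have hb' : t * b = 1 := congr_arg Subtype.val hb'
    obtain ⟨P, rfl⟩ := (Algebra.adjoin_singleton_eq_range_aeval k t).le hb
    have := ht.aeval_ne_zero (P := X * P - 1) (fun h => by
      simpa using congr_arg (fun R => coeff R 0) h)
    exact this (by simpa [sub_eq_zero] using hb')
  obtain ⟨B, hB, hB'⟩ := Ideal.image_subset_nonunits_valuationSubring _ hI
  have htB : B.valuation t < 1 := B.mem_nonunits_iff.1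
    (hB' ⟨⟨t, htA⟩, Ideal.mem_span_singleton_self _, rfl⟩)
  refine ⟨⟨B, fun c => hB (A.algebraMap_mem c), ?_⟩, htB⟩
  rintro rfl
  have h : t⁻¹ ∈ (⊤ : ValuationSubring L) := trivial
  rw [← ValuationSubring.valuation_le_one_iff, map_inv₀,
    inv_le_one₀ (by simpa [zero_lt_iff] using ht.ne_zero)] at h
  exact h.not_gt htB

/-- A place of a rational function field distinct from the zero of the coordinate `t` is not a
pole of `t⁻¹`. -/
theorem val_inv_le_one_of_ne {p q : Place k L} {t : L} (ht : IsCoordinate k t)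
    (hp : p.val t < 1) (hpq : q ≠ p) : q.val t⁻¹ ≤ 1 := by
  rw [map_inv₀, inv_le_one₀ (q.val_pos_of_isCoordinate ht)]
  by_contra! h
  exact hpq (eq_of_isCoordinate ht h hp)

end Basic

section AlgClosed

variable {k L : Type*} [Field k] [IsAlgClosed k] [Field L] [Algebra k L]

theorem exists_val_sub_lt_one_of_aeval (p : Place k L) {f : L} {P : k[X]} (hP : P ≠ 0)
    (h : p.val (aeval f P) < 1) : ∃ c ∈ P.roots, p.val (f - algebraMap k L c) < 1 := by
  have hs := (IsAlgClosed.splits P).eq_prod_roots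
  by_contra! hc
  have h0 := (P.leadingCoeff_ne_zero).2 hP
  rw [hs, map_mul, aeval_C, map_mul, p.val_algebraMap h0, one_mul, map_multiset_prod,
    map_multiset_prod, Multiset.map_map, Multiset.map_map] at h
  refine h.not_ge (Multiset.one_le_prod_of_one_le ?_)
  simp only [Multiset.mem_map]
  rintro _ ⟨c, hcP, rfl⟩
  simpa using hc c hcP

/-- Every place of a rational function field is the zero of some coordinate. -/
theorem exists_isCoordinate {x : L} (hx : IsCoordinate k x) (p : Place k L) :
    ∃ t, IsCoordinate k t ∧ p.val t < 1 := by
  by_cases hpx : p.val x ≤ 1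
  -- If `x` is regular at `p`, some fraction in `x` is not, so its denominator vanishes at `p`, and
  -- so does a linear factor `x - c`.
  · obtain ⟨f, hf⟩ : ∃ f, f ∉ p.ring := by
      by_contra! h
      exact p.ne_top (eq_top_iff.2 fun f _ => h f)
    obtain ⟨P, Q, hQ, rfl⟩ := hx.exists_eq_div f
    rw [← p.val_le_one_iff, map_div₀] at hf
    obtain ⟨c, -, hc⟩ := p.exists_val_sub_lt_one_of_aeval hQ (f := x) (by
      by_contra! h
      exact hf (div_le_one_of_le₀ ((p.val_aeval_le_one hpx P).trans h) zero_le))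
    exact ⟨_, hx.sub_algebraMap c, hc⟩
  · refine ⟨_, hx.inv, ?_⟩
    rw [map_inv₀]
    exact inv_lt_one_of_one_lt₀ (not_le.1 hpx)

end AlgClosed

end Place

end

/-! ### Residue fields, and functions with prescribed poles -/

section

open Polynomial IntermediateField

namespace Place

variable {k L : Type*} [Field k] [Field L] [Algebra k L]

/-- The reversed polynomial has the leading coefficient of `P` as constant term, so it is a unit at
the zero of `t`. -/
theorem val_aeval_inv (p : Place k L) {t : L} (ht : t ≠ 0) (hpt : p.val t < 1) {P : k[X]}
    (hP : P ≠ 0) : p.val (aeval t⁻¹ P) = p.val t⁻¹ ^ P.natDegree := by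
  let _ : Invertible t⁻¹ := invertibleOfNonzero (inv_ne_zero ht)
  have h := eval₂_reverse_mul_pow (algebraMap k L) t⁻¹ P
  rw [invOf_eq_inv, inv_inv, ← aeval_def, ← aeval_def] at h
  rw [← h, map_mul, p.val_aeval_eq_one hpt (by simpa using hP), one_mul, map_pow]

variable [IsAlgClosed k]

/-- The residue field of a place of `k(x)` is `k`. -/
theorem exists_val_sub_algebraMap_lt_one {x : L} (hx : IsCoordinate k x) (p : Place k L) {f : L}
    (hf : p.val f ≤ 1) : ∃ c : k, p.val (f - algebraMap k L c) < 1 := by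
  obtain ⟨t, ht, hpt⟩ := p.exists_isCoordinate hx
  rcases eq_or_ne f 0 with rfl | hf0
  · exact ⟨0, by simp⟩
  obtain ⟨n, P, Q, hP, hQ, rfl⟩ := ht.exists_zpow_mul hf0
  rw [p.val_zpow_mul hpt hP hQ, p.zpow_le_one_iff ht hpt] at hf
  have hQt := p.val_aeval_eq_one hpt hQ
  have hQt0 : aeval t Q ≠ 0 := fun h => by simp [h] at hQt
  lift n to ℕ using hf
  -- Writing `tⁿ` into the numerator treats `n = 0` and `n > 0` together: the residue is the
  -- quotient of the constant terms.
  refine ⟨(X ^ n * P).coeff 0 / Q.coeff 0, ?_⟩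
  have hQ' : algebraMap k L (Q.coeff 0) ≠ 0 := by simpa using hQ
  have key : (t ^ (n : ℤ) * (aeval t P / aeval t Q) -
      algebraMap k L ((X ^ n * P).coeff 0 / Q.coeff 0)) =
      aeval t (C (Q.coeff 0) * (X ^ n * P) - C ((X ^ n * P).coeff 0) * Q) /
        (algebraMap k L (Q.coeff 0) * aeval t Q) := by
    simp only [map_sub, map_mul, aeval_C, map_div₀, map_pow, aeval_X, zpow_natCast]
    field_simp
  rw [key, map_div₀, map_mul, hQt, p.val_algebraMap hQ, mul_one, div_one]
  refine lt_of_le_of_lt (le_of_eq ?_) (p.val_aeval_sub_lt_one hpt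
    (C (Q.coeff 0) * (X ^ n * P) - C ((X ^ n * P).coeff 0) * Q))
  rw [coeff_sub, coeff_C_mul, coeff_C_mul, mul_comm (Q.coeff 0), sub_self, map_zero, sub_zero]

/-- A function on the line without poles away from `p` is a polynomial in a coordinate with
pole `p`. -/
theorem exists_eq_aeval_inv {p : Place k L} {t : L} (ht : IsCoordinate k t) (hpt : p.val t < 1)
    {f : L} (hf : ∀ q, q ≠ p → q.val f ≤ 1) : ∃ P : k[X], f = aeval t⁻¹ P := by
  obtain ⟨P, Q, hQ, ⟨A, B, hAB⟩, rfl⟩ := ht.inv.exists_isCoprime f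
  by_cases hd : Q.degree = 0
  · rw [eq_C_of_degree_eq_zero hd] at hQ ⊢
    have hc : Q.coeff 0 ≠ 0 := by simpa using hQ
    refine ⟨P * C (Q.coeff 0)⁻¹, ?_⟩
    rw [aeval_C, map_mul, aeval_C, map_inv₀, div_eq_mul_inv]
  -- A root of a nonconstant denominator in lowest terms gives a pole of `f` at which `t⁻¹` is
  -- finite, hence a pole other than `p`.
  · exfalso
    obtain ⟨c, hc⟩ := IsAlgClosed.exists_root Q hd
    obtain ⟨q, hq⟩ := exists_val_lt_one (ht.inv.sub_algebraMap c)
    have hqt : q.val t⁻¹ ≤ 1 := by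
      have := q.val.map_add_le hq.le (q.val_algebraMap_le c)
      rwa [sub_add_cancel] at this
    have hqp : q ≠ p := by
      rintro rfl
      rw [map_inv₀, inv_le_one₀ (q.val_pos_of_isCoordinate ht)] at hqt
      exact hqt.not_gt hpt
    have hQ1 : q.val (aeval t⁻¹ Q) < 1 := by
      obtain ⟨R, rfl⟩ := dvd_iff_isRoot.2 hc
      simp only [map_mul, map_sub, aeval_X, aeval_C]
      rw [mul_comm]
      exact mul_lt_one_of_nonneg_of_lt_one_right (q.val_aeval_le_one hqt R) zero_le hq
    have h1 := hf q hqp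
    have hPQ : q.val (aeval t⁻¹ P) ≤ q.val (aeval t⁻¹ Q) := by
      rw [map_div₀] at h1
      refine (div_le_one₀ ?_).1 h1
      simpa [zero_lt_iff] using ht.inv.aeval_ne_zero hQ
    have h2 := congr_arg (fun R => q.val (aeval t⁻¹ R)) hAB
    simp only [map_add, map_mul, map_one] at h2
    refine h2.not_lt (Valuation.map_add_lt _ ?_ ?_) <;> rw [map_mul] <;>
      refine mul_lt_one_of_nonneg_of_lt_one_right (q.val_aeval_le_one hqt _) zero_le ?_
    · exact hPQ.trans_lt hQ1
    · exact hQ1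

theorem exists_eq_algebraMap {x : L} (hx : IsCoordinate k x) {f : L}
    (hf : ∀ q : Place k L, q.val f ≤ 1) : ∃ c : k, f = algebraMap k L c := by
  obtain ⟨p, hp⟩ := exists_val_lt_one hx
  obtain ⟨P, rfl⟩ := exists_eq_aeval_inv hx hp fun q _ => hf q
  rcases eq_or_ne P 0 with rfl | hP
  · exact ⟨0, by simp⟩
  have h := hf p
  rw [val_aeval_inv p hx.ne_zero hp hP, map_inv₀, inv_pow,
    inv_le_one₀ (pow_pos (p.val_pos_of_isCoordinate hx) _)] at h
  have hd : P.natDegree = 0 := by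
    by_contra hd
    exact h.not_gt (pow_lt_one₀ zero_le hp hd)
  exact ⟨P.coeff 0, by conv_lhs => rw [eq_C_of_natDegree_eq_zero hd, aeval_C]⟩

/-- A coordinate vanishing at a given place and a unit at finitely many others. -/
theorem exists_isCoordinate_of_finite {x : L} (hx : IsCoordinate k x) (p : Place k L)
    {S : Set (Place k L)} (hS : S.Finite) (hp : p ∉ S) :
    ∃ t, IsCoordinate k t ∧ p.val t < 1 ∧ ∀ q ∈ S, q.val t = 1 := by
  obtain ⟨t, ht, hpt⟩ := p.exists_isCoordinate hx
  have hr : ∀ q : S, ∃ c : k, q.1.val (t⁻¹ - algebraMap k L c) < 1 := fun q =>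
    exists_val_sub_algebraMap_lt_one hx q.1
      (val_inv_le_one_of_ne ht hpt (by rintro rfl; exact hp q.2))
  choose c hc using hr
  have := hS.to_subtype
  -- As `k` is infinite, some `b` is not a value of `t⁻¹` on `S`. Then `(t⁻¹ - b)⁻¹` still vanishes
  -- at `p` and is a unit on `S`.
  obtain ⟨b, hb⟩ := (Set.finite_range c).infinite_compl.nonempty
  refine ⟨(t⁻¹ - algebraMap k L b)⁻¹, (ht.inv.sub_algebraMap b).inv, ?_, fun q hq => ?_⟩
  · have h1 : 1 < p.val t⁻¹ := by
      rw [map_inv₀]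
      exact one_lt_inv_iff₀.2 ⟨p.val_pos_of_isCoordinate ht, hpt⟩
    rw [map_inv₀, Valuation.map_sub_eq_of_lt_left _ ((p.val_algebraMap_le b).trans_lt h1)]
    exact inv_lt_one_of_one_lt₀ h1
  · rw [map_inv₀, inv_eq_one]
    have hbc : c ⟨q, hq⟩ - b ≠ 0 := sub_ne_zero.2 fun h => hb ⟨_, h⟩
    refine q.val_eq_one_of_sub_lt hbc ?_
    have := hc ⟨q, hq⟩
    simpa [sub_sub] using this

end Place

end

/-! ### Automorphisms of the line: cotangent multipliers and involutions -/

section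

open Polynomial IntermediateField

open scoped Pointwise

namespace Place

section Action

variable {k L : Type*} [Field k] [Field L] [Algebra k L]

/-- Automorphisms of `L/k` act on places. -/
instance : MulAction (L ≃ₐ[k] L) (Place k L) where
  smul g p :=
    { ring := g • p.ring
      algebraMap_mem := fun c =>
        (ValuationSubring.mem_smul_pointwise_iff_exists _ _ _).2
          ⟨_, p.algebraMap_mem c, g.commutes c⟩
      ne_top := fun h => p.ne_top (by
        rw [eq_top_iff]
        intro f _
        rw [← ValuationSubring.smul_mem_pointwise_smul_iff (g := g), h]
        trivial) }
  one_smul p := Place.ext (one_smul _ p.ring)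
  mul_smul g h p := Place.ext (mul_smul g h p.ring)

variable (g : L ≃ₐ[k] L) (p : Place k L)

theorem map_mem_smul_ring {f : L} : g f ∈ (g • p).ring ↔ f ∈ p.ring :=
  ValuationSubring.smul_mem_pointwise_smul_iff

theorem val_smul_map_le_iff {f h : L} :
    (g • p).val (g f) ≤ (g • p).val (g h) ↔ p.val f ≤ p.val h := by
  rw [ValuationSubring.valuation_le_iff, ValuationSubring.valuation_le_iff]
  constructor
  · rintro ⟨⟨a, ha⟩, hah⟩
    refine ⟨⟨g.symm a, (map_mem_smul_ring g p).1 (by simpa using ha)⟩, g.injective ?_⟩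
    simpa using hah
  · rintro ⟨⟨a, ha⟩, hah⟩
    refine ⟨⟨g a, (map_mem_smul_ring g p).2 ha⟩, ?_⟩
    simp [← hah]

theorem val_smul_map_lt_iff {f h : L} :
    (g • p).val (g f) < (g • p).val (g h) ↔ p.val f < p.val h := by
  rw [← not_le, ← not_le, val_smul_map_le_iff]

theorem val_smul_map_eq_iff {f h : L} :
    (g • p).val (g f) = (g • p).val (g h) ↔ p.val f = p.val h := by
  rw [le_antisymm_iff, le_antisymm_iff, val_smul_map_le_iff, val_smul_map_le_iff]

theorem val_smul_map_le_one_iff {f : L} : (g • p).val (g f) ≤ 1 ↔ p.val f ≤ 1 := by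
  simpa using val_smul_map_le_iff g p (f := f) (h := 1)

theorem val_smul_map_lt_one_iff {f : L} : (g • p).val (g f) < 1 ↔ p.val f < 1 := by
  simpa using val_smul_map_lt_iff g p (f := f) (h := 1)

theorem val_smul_map_eq_one_iff {f : L} : (g • p).val (g f) = 1 ↔ p.val f = 1 := by
  simpa using val_smul_map_eq_iff g p (f := f) (h := 1)

variable {g p}

theorem val_map_lt_one_iff (hg : g • p = p) {f : L} : p.val (g f) < 1 ↔ p.val f < 1 := by
  conv_lhs => rw [← hg]
  exact val_smul_map_lt_one_iff g p

theorem val_map_le_one_iff (hg : g • p = p) {f : L} : p.val (g f) ≤ 1 ↔ p.val f ≤ 1 := by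
  conv_lhs => rw [← hg]
  exact val_smul_map_le_one_iff g p

theorem val_map_eq_one_iff (hg : g • p = p) {f : L} : p.val (g f) = 1 ↔ p.val f = 1 := by
  conv_lhs => rw [← hg]
  exact val_smul_map_eq_one_iff g p

theorem val_map_lt_iff (hg : g • p = p) {f h : L} :
    p.val (g f) < p.val (g h) ↔ p.val f < p.val h := by
  conv_lhs => rw [← hg]
  exact val_smul_map_lt_iff g p

theorem val_map_eq_of_isCoordinate (hg : g • p = p) {t : L} (ht : IsCoordinate k t)
    (hpt : p.val t < 1) : p.val (g t) = p.val t :=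
  p.val_eq_val_of_isCoordinate (ht.map g) ht ((val_map_lt_one_iff hg).2 hpt) hpt

theorem eq_of_val_map_lt_one {t : L} (ht : IsCoordinate k t) (hpt : p.val t < 1)
    (h : p.val (g t) < 1) : g • p = p :=
  eq_of_isCoordinate (ht.map g) ((val_smul_map_lt_one_iff g p).2 hpt) h

end Action

section Multiplier

variable {k L : Type*} [Field k] [Field L] [Algebra k L]

/-- The automorphism `g` acts on the cotangent line at its fixed place `p` as
multiplication by `a`. -/
structure HasMultiplier (p : Place k L) (g : L ≃ₐ[k] L) (a : k) : Prop where
  smul_eq : g • p = p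
  val_sub_lt : ∀ t, IsCoordinate k t → p.val t < 1 →
    p.val (g t - algebraMap k L a * t) < p.val t

theorem HasMultiplier.mul {p : Place k L} {g h : L ≃ₐ[k] L} {a b : k} (hg : p.HasMultiplier g a)
    (hh : p.HasMultiplier h b) : p.HasMultiplier (g * h) (a * b) := by
  refine ⟨by rw [mul_smul, hh.1, hg.1], fun t ht hpt => ?_⟩
  have h1 := hh.2 t ht hpt
  have h2 := hg.2 t ht hpt
  rw [← val_map_lt_iff hg.1, val_map_eq_of_isCoordinate hg.1 ht hpt] at h1
  have h3 : p.val (algebraMap k L b * (g t - algebraMap k L a * t)) < p.val t := by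
    rw [map_mul]
    exact (mul_le_of_le_one_left zero_le (p.val_algebraMap_le b)).trans_lt h2
  refine lt_of_le_of_lt (le_of_eq ?_) (p.val.map_add_lt h1 h3)
  congr 1
  simp only [AlgEquiv.mul_apply, map_sub, map_mul, AlgEquiv.commutes]
  ring

theorem HasMultiplier.unique {x : L} {p : Place k L} {g : L ≃ₐ[k] L} {a b : k}
    (hx : IsCoordinate k x) (hpx : p.val x < 1) (ha : p.HasMultiplier g a)
    (hb : p.HasMultiplier g b) : a = b := by
  have h := p.val.map_sub_lt (ha.2 x hx hpx) (hb.2 x hx hpx)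
  rw [sub_sub_sub_cancel_left, ← sub_mul, ← map_sub, map_mul] at h
  by_contra hab
  rw [p.val_algebraMap (sub_ne_zero.2 (Ne.symm hab)), one_mul] at h
  exact h.false

theorem hasMultiplier_one (p : Place k L) : p.HasMultiplier 1 1 :=
  ⟨one_smul _ p, fun t ht _ => by simpa using p.val_pos_of_isCoordinate ht⟩

variable [IsAlgClosed k]

/-- The residue `a` of `g t / t` for one uniformizer `t` serves for all: any other is `c t` plus
terms of higher order, which `g` preserves. -/
theorem exists_hasMultiplier {x : L} (hx : IsCoordinate k x) {p : Place k L} {g : L ≃ₐ[k] L}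
    (hg : g • p = p) : ∃ a, p.HasMultiplier g a := by
  obtain ⟨t, ht, hpt⟩ := p.exists_isCoordinate hx
  have h1 : p.val (g t / t) = 1 := by
    rw [map_div₀, val_map_eq_of_isCoordinate hg ht hpt]
    exact div_self (p.val_pos_of_isCoordinate ht).ne'
  obtain ⟨a, ha⟩ := p.exists_val_sub_algebraMap_lt_one hx h1.le
  have hta : p.val (g t - algebraMap k L a * t) < p.val t := by
    have h := mul_lt_mul_of_pos_right ha (p.val_pos_of_isCoordinate ht)
    rwa [← map_mul, sub_mul, div_mul_cancel₀ _ ht.ne_zero, one_mul] at h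
  refine ⟨a, hg, fun u hu hpu => ?_⟩
  have h2 : p.val (u / t) = 1 := by
    rw [map_div₀, p.val_eq_val_of_isCoordinate hu ht hpu hpt]
    exact div_self (p.val_pos_of_isCoordinate ht).ne'
  obtain ⟨c, hc⟩ := p.exists_val_sub_algebraMap_lt_one hx h2.le
  have huc : p.val (u - algebraMap k L c * t) < p.val t := by
    have h := mul_lt_mul_of_pos_right hc (p.val_pos_of_isCoordinate ht)
    rwa [← map_mul, sub_mul, div_mul_cancel₀ _ ht.ne_zero, one_mul] at h
  have key : g u - algebraMap k L a * u = g (u - algebraMap k L c * t) +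
      algebraMap k L c * (g t - algebraMap k L a * t) -
      algebraMap k L a * (u - algebraMap k L c * t) := by
    simp only [map_sub, map_mul, AlgEquiv.commutes]
    ring
  have hmul : ∀ (b : k) (f : L), p.val f < p.val t → p.val (algebraMap k L b * f) < p.val t := by
    intro b f hf
    rw [map_mul]
    exact (mul_le_of_le_one_left zero_le (p.val_algebraMap_le b)).trans_lt hf
  rw [key, p.val_eq_val_of_isCoordinate hu ht hpu hpt]
  refine p.val.map_sub_lt (p.val.map_add_lt ?_ (hmul _ _ hta)) (hmul _ _ huc)
  rwa [← val_map_eq_of_isCoordinate hg ht hpt, val_map_lt_iff hg]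

/-- A finite-order automorphism fixing a place and acting trivially on its cotangent line is
trivial. -/
theorem HasMultiplier.eq_one [CharZero k] {x : L} (hx : IsCoordinate k x) {p : Place k L}
    {g : L ≃ₐ[k] L} (hg : p.HasMultiplier g 1) (hfin : IsOfFinOrder g) : g = 1 := by
  obtain ⟨t, ht, hpt⟩ := p.exists_isCoordinate hx
  have h0 := p.val_pos_of_isCoordinate ht
  -- The only pole of `g t⁻¹` is `p`, and it is simple, so `g t⁻¹ = a t⁻¹ + b`.
  obtain ⟨P, hP⟩ := exists_eq_aeval_inv ht hpt (f := g t⁻¹) (fun q hq => by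
    rw [map_inv₀]
    refine val_inv_le_one_of_ne (ht.map g) ?_ hq
    exact (val_map_lt_one_iff hg.1).2 hpt)
  have hP0 : P ≠ 0 := by
    rintro rfl
    simp [ht.ne_zero] at hP
  have hdeg : P.natDegree = 1 := by
    have h := congr_arg p.val hP
    rw [p.val_aeval_inv ht.ne_zero hpt hP0, map_inv₀, map_inv₀,
      val_map_eq_of_isCoordinate hg.1 ht hpt, map_inv₀] at h
    nth_rewrite 1 [← pow_one (p.val t)⁻¹] at h
    exact (pow_right_injective₀ (inv_pos.2 h0) (by simpa using hpt.ne) h).symm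
  rw [eq_X_add_C_of_natDegree_le_one hdeg.le] at hP
  set a := P.coeff 1
  set b := P.coeff 0
  simp only [map_add, map_mul, aeval_C, aeval_X, map_inv₀] at hP
  have hgt0 : g t ≠ 0 := (ht.map g).ne_zero
  have h1 := hg.2 t ht hpt
  rw [map_one, one_mul] at h1
  have ht0 := ht.ne_zero
  have key : algebraMap k L (1 - a) * t =
      algebraMap k L a * (g t - t) + algebraMap k L b * (t * g t) := by
    field_simp at hP
    rw [map_sub, map_one]
    linear_combination hP
  have ha : 1 - a = 0 := by
    by_contra ha
    have h2 : p.val (algebraMap k L (1 - a) * t) < p.val t := by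
      rw [key]
      refine p.val.map_add_lt ?_ ?_
      · rw [map_mul]
        exact (mul_le_of_le_one_left zero_le (p.val_algebraMap_le a)).trans_lt h1
      · rw [map_mul, map_mul]
        refine (mul_le_of_le_one_left zero_le (p.val_algebraMap_le b)).trans_lt ?_
        rw [val_map_eq_of_isCoordinate hg.1 ht hpt]
        exact mul_lt_of_lt_one_left h0 hpt
    rw [map_mul, p.val_algebraMap ha, one_mul] at h2
    exact h2.false
  obtain ha : a = 1 := by linear_combination -ha
  rw [ha, map_one, one_mul, ← map_inv₀] at hP
  -- With `a = 1`, `g` is the translation `t⁻¹ ↦ t⁻¹ + b`, of infinite order in characteristic zero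
  -- unless `b = 0`.
  have hpow : ∀ n : ℕ, (g ^ n) t⁻¹ = t⁻¹ + n * algebraMap k L b := by
    intro n
    induction n with
    | zero => simp
    | succ n ih =>
      rw [pow_succ, AlgEquiv.mul_apply, hP, map_add, ih, AlgEquiv.commutes]
      push_cast
      ring
  obtain ⟨n, hn, hgn⟩ := isOfFinOrder_iff_pow_eq_one.1 hfin
  have h3 := hpow n
  rw [hgn, AlgEquiv.one_apply, left_eq_add, ← map_natCast (algebraMap k L), ← map_mul,
    map_eq_zero, mul_eq_zero, Nat.cast_eq_zero] at h3
  have hb : b = 0 := h3.resolve_left hn.ne'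
  rw [hb, map_zero, add_zero] at hP
  exact ht.inv.algEquiv_ext (by simpa using hP)

theorem hasMultiplier_neg_one_of_involution [CharZero k] {x : L} (hx : IsCoordinate k x)
    {p : Place k L} {s : L ≃ₐ[k] L} (hs : s * s = 1) (hs1 : s ≠ 1) (hp : s • p = p) :
    p.HasMultiplier s (-1) := by
  obtain ⟨a, ha⟩ := exists_hasMultiplier hx hp
  obtain ⟨t, ht, hpt⟩ := p.exists_isCoordinate hx
  have h := ha.mul ha
  rw [hs] at h
  rcases mul_self_eq_one_iff.1 (h.unique ht hpt p.hasMultiplier_one) with rfl | rfl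
  · exact absurd (ha.eq_one hx (isOfFinOrder_iff_pow_eq_one.2 ⟨2, two_pos, by rw [sq, hs]⟩)) hs1
  · exact ha

/-- Distinct involutions whose product has finite order have no common fixed place. -/
theorem eq_of_involutions_fix [CharZero k] {x : L} (hx : IsCoordinate k x)
    {p : Place k L} {s s' : L ≃ₐ[k] L} (hs : s * s = 1) (hs1 : s ≠ 1) (hp : s • p = p)
    (hs' : s' * s' = 1) (hs1' : s' ≠ 1) (hp' : s' • p = p) (hss' : IsOfFinOrder (s * s')) :
    s = s' := by
  -- The product has multiplier `(-1)(-1) = 1` at `p`.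
  have h := (hasMultiplier_neg_one_of_involution hx hs hs1 hp).mul
    (hasMultiplier_neg_one_of_involution hx hs' hs1' hp')
  rw [neg_one_mul, neg_neg] at h
  rw [← mul_left_inj s', h.eq_one hx hss', hs']

/-- A nontrivial automorphism of the line moves some place. -/
theorem exists_smul_ne {x : L} (hx : IsCoordinate k x) {s : L ≃ₐ[k] L} (hs : s ≠ 1) :
    ∃ p : Place k L, s • p ≠ p := by
  by_contra! h
  -- If every place is fixed, `s t / t` has no poles, so it is constant. Applied to `x` and `x - 1`,
  -- this gives `a x - 1 = b (x - 1)`, whence `a = b = 1`.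
  have hconst : ∀ t : L, IsCoordinate k t → ∃ c : k, s t = algebraMap k L c * t := by
    intro t ht
    obtain ⟨c, hc⟩ := exists_eq_algebraMap hx (f := s t / t) (fun q => by
      rw [map_div₀]
      refine div_le_one_of_le₀ (le_of_eq ?_) zero_le
      rcases lt_trichotomy (q.val t) 1 with h1 | h1 | h1
      · exact val_map_eq_of_isCoordinate (h q) ht h1
      · rw [h1, val_map_eq_one_iff (h q), h1]
      · have h2 := val_map_eq_of_isCoordinate (h q) ht.inv
          (by rw [map_inv₀]; exact inv_lt_one_of_one_lt₀ h1)
        simpa using h2)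
    exact ⟨c, by rw [← hc, div_mul_cancel₀ _ ht.ne_zero]⟩
  obtain ⟨a, ha⟩ := hconst x hx
  obtain ⟨b, hb⟩ := hconst _ (hx.sub_algebraMap 1)
  have h1 : aeval x (C (a - b) * X + C (b - 1)) = 0 := by
    rw [map_one, map_sub, map_one, ha] at hb
    simp only [map_add, map_mul, aeval_C, aeval_X, map_sub, map_one]
    linear_combination hb
  have h2 : C (a - b) * X + C (b - 1) = 0 := by
    by_contra h3
    exact hx.aeval_ne_zero h3 h1
  have hb1 := congr_arg (fun P => coeff P 0) h2
  have hab := congr_arg (fun P => coeff P 1) h2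
  simp [coeff_X, coeff_one, coeff_C] at hb1 hab
  refine hs (hx.algEquiv_ext ?_)
  rw [ha, sub_eq_zero.1 hab, sub_eq_zero.1 hb1]
  simp

/-- An involution of the line is `T ↦ -T` in a suitable coordinate `T`. -/
theorem exists_map_eq_neg [CharZero k] {x : L} (hx : IsCoordinate k x) {s : L ≃ₐ[k] L}
    (hs : s * s = 1) (hs1 : s ≠ 1) : ∃ T, IsCoordinate k T ∧ s T = -T := by
  obtain ⟨p, hp⟩ := exists_smul_ne hx hs1
  have hssp : s • s • p = p := by rw [← mul_smul, hs, one_smul]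
  have hss : ∀ f, s (s f) = f := fun f => by rw [← AlgEquiv.mul_apply, hs, AlgEquiv.one_apply]
  obtain ⟨t, ht, hpt⟩ := p.exists_isCoordinate hx
  obtain ⟨b, hb⟩ := (s • p).exists_val_sub_algebraMap_lt_one hx
    (val_inv_le_one_of_ne ht hpt hp)
  -- `w` has its pole at `p` and its zero at `s • p`
  set w := t⁻¹ - algebraMap k L b with hw_def
  have hw : IsCoordinate k w := ht.inv.sub_algebraMap b
  have hpw : p.val w⁻¹ < 1 := by
    have h1 : 1 < p.val t⁻¹ := by
      rw [map_inv₀]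
      exact one_lt_inv_iff₀.2 ⟨p.val_pos_of_isCoordinate ht, hpt⟩
    rw [map_inv₀, Valuation.map_sub_eq_of_lt_left _ ((p.val_algebraMap_le b).trans_lt h1)]
    exact inv_lt_one_of_one_lt₀ h1
  have hsw : p.val (s w) < 1 := by
    rw [← val_smul_map_lt_one_iff s, hss]
    exact hb
  have hsw' : (s • p).val (s w)⁻¹ < 1 := by
    rw [← map_inv₀]
    exact (val_smul_map_lt_one_iff s p).2 hpw
  -- The zeros and poles of `w` and `s w` cancel, so `w * s w` is a constant, written below as `l²`.
  -- The involution `w ↦ l² / w` fixes the values `±l`, and `T = (w - l) / (w + l)` sends them to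
  -- `0` and `∞`.
  obtain ⟨c, hc⟩ := exists_eq_algebraMap hx (f := w * s w) (fun q => by
    rw [map_mul]
    by_cases hqp : q = p
    · subst hqp
      rw [q.val_eq_val_of_isCoordinate (hw.map s) hw.inv hsw hpw, map_inv₀,
        mul_inv_cancel₀ (q.val_pos_of_isCoordinate hw).ne']
    by_cases hqs : q = s • p
    · subst hqs
      rw [val_eq_val_of_isCoordinate _ hw (hw.map s).inv hb hsw', map_inv₀,
        inv_mul_cancel₀ (val_pos_of_isCoordinate _ (hw.map s)).ne']
    · refine mul_le_one' ?_ ?_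
      · simpa using val_inv_le_one_of_ne hw.inv hpw hqp
      · simpa using val_inv_le_one_of_ne (hw.map s).inv hsw' hqs)
  obtain ⟨l, hl⟩ := IsAlgClosed.exists_pow_nat_eq c two_pos
  have hw0 := hw.ne_zero
  have hsw0 := (hw.map s).ne_zero
  have hl0 : l ≠ 0 := by
    rintro rfl
    rw [← hl] at hc
    simp [hw0] at hc
  have hwl := (hw.sub_algebraMap (-l)).ne_zero
  have hwl' := (hw.sub_algebraMap l).ne_zero
  have hL0 : algebraMap k L l ≠ 0 := by simpa using hl0
  have hcl : w * s w = algebraMap k L l ^ 2 := by rw [hc, ← hl, map_pow]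
  rw [map_neg, sub_neg_eq_add] at hwl
  have hT : IsCoordinate k ((w - algebraMap k L l) / (w + algebraMap k L l)) := by
    -- `T = 1 - 2l / (w + l)`.
    have h1 := (((hw.sub_algebraMap (-l)).inv.algebraMap_mul (c := -2 * l)
      (mul_ne_zero (by simp) hl0)).sub_algebraMap (-1))
    convert h1 using 1
    simp only [map_neg, map_mul, map_one, map_ofNat, sub_neg_eq_add]
    field_simp
    ring
  refine ⟨_, hT, ?_⟩
  rw [map_div₀, map_sub, map_add, AlgEquiv.commutes]
  have hswl : s w + algebraMap k L l ≠ 0 := by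
    have := ((hw.map s).sub_algebraMap (-l)).ne_zero
    rwa [map_neg, sub_neg_eq_add] at this
  rw [← neg_div, div_eq_div_iff hswl hwl]
  linear_combination 2 * hcl

/-- An involution of the line has exactly two fixed places. -/
theorem ncard_fixed_involution [CharZero k] {x : L} (hx : IsCoordinate k x) {s : L ≃ₐ[k] L}
    (hs : s * s = 1) (hs1 : s ≠ 1) : {p : Place k L | s • p = p}.ncard = 2 := by
  obtain ⟨T, hT, hsT⟩ := exists_map_eq_neg hx hs hs1
  obtain ⟨p, hp⟩ := exists_val_lt_one hT
  obtain ⟨q, hq⟩ := exists_val_lt_one hT.inv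
  have hpq : p ≠ q := by
    rintro rfl
    rw [map_inv₀, inv_lt_one₀ (p.val_pos_of_isCoordinate hT)] at hq
    exact lt_asymm hp hq
  rw [Set.ncard_eq_two]
  refine ⟨p, q, hpq, ?_⟩
  ext r
  simp only [Set.mem_ofPred_eq, Set.mem_insert_iff, Set.mem_singleton_iff]
  constructor
  · intro hr
    by_contra! hne
    -- At a fixed place where `T` has a finite value `c`, so has `-T`; hence `2c = 0`.
    have hT1 : r.val T ≤ 1 := by simpa using val_inv_le_one_of_ne hT.inv hq hne.2
    obtain ⟨c, hc⟩ := r.exists_val_sub_algebraMap_lt_one hx hT1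
    have h1 := (val_map_lt_one_iff hr).2 hc
    rw [map_sub, AlgEquiv.commutes, hsT] at h1
    have h2 := r.val.map_add_lt hc h1
    have h3 : T - algebraMap k L c + (-T - algebraMap k L c) = algebraMap k L (-2 * c) := by
      simp only [map_mul, map_neg, map_ofNat]
      ring
    rw [h3, val_algebraMap_lt_one_iff] at h2
    have hc0 : c = 0 := by simpa using h2
    rw [hc0, map_zero, sub_zero] at hc
    exact hne.1 (eq_of_isCoordinate hT hc hp)
  · rintro (rfl | rfl)
    · exact eq_of_val_map_lt_one hT hp (by rwa [hsT, Valuation.map_neg])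
    · exact eq_of_val_map_lt_one hT.inv hq (by rwa [map_inv₀, hsT, inv_neg, Valuation.map_neg])

end Multiplier

end Place

end

/-! ### Ramification in the quotient by a finite group -/

section

open Polynomial IntermediateField

namespace Place

theorem ramificationIndex_eq_one_iff {k E L : Type*} [Field k] [Field E] [Field L] [Algebra k L]
    [Algebra E L] (P : Place k L) :
    P.ramificationIndex E = 1 ↔ ∀ f : L, f ≠ 0 → ∃ h : E, P.val (algebraMap E L h) = P.val f := by
  rw [ramificationIndex, Subgroup.index_eq_one, MonoidHom.range_eq_top]
  constructor
  · intro H f hf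
    obtain ⟨u, hu⟩ := H (Units.mk0 (P.val f) (by simpa using hf))
    exact ⟨u, congr_arg Units.val hu⟩
  · intro H u
    obtain ⟨f, hf⟩ := P.ring.valuation_surjective u
    have hf0 : f ≠ 0 := by
      rintro rfl
      rw [map_zero] at hf
      exact u.ne_zero hf.symm
    obtain ⟨h, hh⟩ := H f hf0
    have hh0 : h ≠ 0 := by
      rintro rfl
      rw [map_zero, map_zero, eq_comm, map_eq_zero] at hh
      exact hf0 hh
    exact ⟨Units.mk0 h hh0, Units.ext (hh.trans hf)⟩

section

variable {k L : Type*} [Field k] [IsAlgClosed k] [Field L] [Algebra k L]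
  {G : Subgroup (L ≃ₐ[k] L)} [Finite G] {E : IntermediateField k L}

/-- Given a place `p` and finitely many places that are not conjugate to it, some invariant
function vanishes at `p` and at none of the others; its value at `p` is that of a coordinate when
`p` has trivial stabilizer. -/
theorem exists_invariant {x : L} (hx : IsCoordinate k x)
    (hE : ∀ f, f ∈ E ↔ ∀ g ∈ G, g f = f) (p : Place k L) {S : Set (Place k L)} (hS : S.Finite)
    (hSp : ∀ q ∈ S, ∀ g ∈ G, g • q ≠ p) :
    ∃ t, IsCoordinate k t ∧ p.val t < 1 ∧ ∃ f ∈ E, f ≠ 0 ∧ p.val f < 1 ∧ (∀ q ∈ S, q.val f = 1) ∧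
      ((∀ g ∈ G, g • p = p → g = 1) → p.val f = p.val t) := by
  classical
  have := Fintype.ofFinite G
  obtain ⟨t, ht, hpt, htS⟩ := exists_isCoordinate_of_finite hx p
    (S := (⋃ g : G, (fun q => g.1 • q) '' S) ∪ ((fun g : G => g.1 • p) '' Set.univ) \ {p})
    ((Set.finite_iUnion fun g => hS.image _).union ((Set.toFinite _).sdiff)) (by
      simp only [Set.mem_union, Set.mem_iUnion, Set.mem_image, Set.mem_sdiff, not_or, not_exists]
      refine ⟨fun g q hq => hSp q hq.1 g g.2 hq.2, fun h => h.2 rfl⟩)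
  have hval : ∀ (q : Place k L) (g : L ≃ₐ[k] L), (g⁻¹ • q).val t = 1 → q.val (g t) = 1 := by
    intro q g h
    rwa [← val_smul_map_eq_one_iff g, smul_inv_smul] at h
  have hval1 : ∀ g ∈ G, g⁻¹ • p ≠ p → p.val (g t) = 1 := fun g hg hgp =>
    hval p g (htS _ (Or.inr ⟨⟨⟨g⁻¹, inv_mem hg⟩, trivial, rfl⟩, hgp⟩))
  have hle : ∀ g ∈ G, p.val (g t) ≤ 1 := by
    intro g hg
    by_cases hgp : g⁻¹ • p = p
    · exact (val_map_le_one_iff (by rw [← hgp, smul_inv_smul, hgp])).2 hpt.le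
    · exact (hval1 g hg hgp).le
  -- The norm of `t`. The only conjugates of `t` that can vanish at `p` are those by elements whose
  -- inverses fix `p`.
  refine ⟨t, ht, hpt, ∏ g : G, g.1 t, (hE _).2 fun h hh => ?_, ?_, ?_, fun q hq => ?_, fun hp => ?_⟩
  · rw [map_prod]
    exact Fintype.prod_equiv (Equiv.mulLeft (⟨h, hh⟩ : G)) _ _ fun g => rfl
  · exact Finset.prod_ne_zero_iff.2 fun g _ => (ht.map g.1).ne_zero
  · rw [Fintype.prod_eq_mul_prod_compl 1, map_mul]
    refine mul_lt_one_of_nonneg_of_lt_one_left zero_le hpt ?_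
    rw [map_prod]
    exact Finset.prod_le_one' fun g _ => hle g g.2
  · rw [map_prod]
    refine Finset.prod_eq_one fun g _ => hval q g (htS _ (Or.inl ?_))
    exact Set.mem_iUnion.2 ⟨g⁻¹, q, hq, rfl⟩
  · rw [map_prod, Fintype.prod_eq_single (1 : G)]
    · rfl
    · intro g hg
      refine hval1 g g.2 fun h => hg ?_
      simpa using hp _ (inv_mem g.2) h

/-- A trivial stabilizer provides an invariant uniformizer, so all values come from `E`. Conversely,
an invariant function with the value of a uniformizer forces every element of the stabilizer to have
multiplier 1, hence to be trivial. -/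
theorem isRamified_iff [CharZero k] {x : L} (hx : IsCoordinate k x)
    (hE : ∀ f, f ∈ E ↔ ∀ g ∈ G, g f = f) (p : Place k L) :
    p.IsRamified E ↔ ∃ g ∈ G, g ≠ 1 ∧ g • p = p := by
  rw [IsRamified, Ne, ramificationIndex_eq_one_iff]
  constructor
  · contrapose!
    intro hp f hf
    obtain ⟨t, ht, hpt, h, hhE, h0, -, -, hht⟩ := exists_invariant hx hE p Set.finite_empty
      (by simp)
    obtain ⟨n, hn⟩ := p.exists_val_eq_zpow ht hpt hf
    refine ⟨⟨h, hhE⟩ ^ n, ?_⟩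
    rw [map_zpow₀, map_zpow₀, hn, ← hht fun g hg hgp => by_contra fun h1 => hp g hg h1 hgp]
    rfl
  · rintro ⟨g, hg, hg1, hgp⟩ H
    obtain ⟨t, ht, hpt⟩ := p.exists_isCoordinate hx
    obtain ⟨⟨h, hhE⟩, hh⟩ := H t ht.ne_zero
    change p.val h = p.val t at hh
    have h0 := p.val_pos_of_isCoordinate ht
    have h1 : p.val (h / t) = 1 := by rw [map_div₀, hh, div_self h0.ne']
    obtain ⟨c, hc⟩ := p.exists_val_sub_algebraMap_lt_one hx h1.le
    have hc0 : c ≠ 0 := by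
      rintro rfl
      rw [map_zero, sub_zero, h1] at hc
      exact hc.false
    have h2 := mul_lt_mul_of_pos_right hc h0
    rw [← map_mul, sub_mul, div_mul_cancel₀ _ ht.ne_zero, one_mul] at h2
    have h3 := h2
    rw [← val_map_lt_iff hgp, val_map_eq_of_isCoordinate hgp ht hpt, map_sub, map_mul,
      AlgEquiv.commutes, (hE h).1 hhE g hg] at h2
    obtain ⟨a, ha⟩ := exists_hasMultiplier hx hgp
    have h4 : p.val (g t - t) < p.val t := by
      have h5 := p.val.map_sub_lt h3 h2
      rw [sub_sub_sub_cancel_left, ← mul_sub, map_mul, p.val_algebraMap hc0, one_mul] at h5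
      exact h5
    have h6 := p.val.map_sub_lt h4 (ha.2 t ht hpt)
    rw [sub_sub_sub_cancel_left, ← sub_one_mul, ← map_one (algebraMap k L), ← map_sub, map_mul,
      mul_lt_iff_lt_one_left h0, val_algebraMap_lt_one_iff, sub_eq_zero] at h6
    rw [h6] at ha
    refine hg1 (ha.eq_one hx ?_)
    exact G.subtype.isOfFinOrder (isOfFinOrder_of_finite (⟨g, hg⟩ : G))

/-- A place of the line lies over a branch point of the quotient by a finite group if and only
if its stabilizer is nontrivial. -/
theorem exists_liesOver_branchPlaces_iff [CharZero k] {x : L} (hx : IsCoordinate k x)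
    (hE : ∀ f, f ∈ E ↔ ∀ g ∈ G, g f = f) (p : Place k L) :
    (∃ q ∈ branchPlaces k E L, p.LiesOver q) ↔ ∃ g ∈ G, g ≠ 1 ∧ g • p = p := by
  constructor
  · rintro ⟨q, ⟨P, hPq, hP⟩, hpq⟩
    obtain ⟨g, hg, hg1, hgP⟩ := (isRamified_iff hx hE P).1 hP
    by_cases hc : ∃ h ∈ G, h • P = p
    · obtain ⟨h, hh, rfl⟩ := hc
      refine ⟨h * g * h⁻¹, mul_mem (mul_mem hh hg) (inv_mem hh), ?_, ?_⟩
      · rwa [Ne, conj_eq_one_iff]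
      · rw [mul_smul, inv_smul_smul, mul_smul, hgP]
    -- If `P` and `p` were not conjugate, an invariant function vanishing at `p` and a unit at `P`
    -- would separate their restrictions to `E`.
    · push Not at hc
      obtain ⟨-, -, -, f, hfE, hf0, hpf, hPf, -⟩ := exists_invariant hx hE p
        (Set.finite_singleton P) (by rintro _ rfl; exact hc)
      exfalso
      have h1 : (⟨f, hfE⟩ : E)⁻¹ ∈ P.ring.comap (algebraMap E L) := by
        change f⁻¹ ∈ P.ring
        rw [← P.val_le_one_iff, map_inv₀, hPf P rfl, inv_one]
      rw [hPq, ← hpq] at h1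
      change f⁻¹ ∈ p.ring at h1
      rw [← p.val_le_one_iff, map_inv₀, inv_le_one₀ (by simpa [zero_lt_iff] using hf0)] at h1
      exact h1.not_gt hpf
  · intro h
    obtain ⟨-, -, -, f, hfE, hf0, hpf, -⟩ := exists_invariant hx hE p Set.finite_empty (by simp)
    refine ⟨⟨p.ring.comap (algebraMap E L), fun c => p.algebraMap_mem c, fun htop => ?_⟩,
      ⟨p, rfl, (isRamified_iff hx hE p).2 h⟩, rfl⟩
    have h1 : (⟨f, hfE⟩ : E)⁻¹ ∈ p.ring.comap (algebraMap E L) := by rw [htop]; trivial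
    change f⁻¹ ∈ p.ring at h1
    rw [← p.val_le_one_iff, map_inv₀, inv_le_one₀ (by simpa [zero_lt_iff] using hf0)] at h1
    exact h1.not_gt hpf

end

end Place

end

/-! ### Places above a given place, and ramification in quadratic extensions -/

section

open Polynomial IntermediateField

namespace Place

section LiesOver

variable {k E L : Type*} [Field k] [Field E] [Field L] [Algebra k E] [Algebra k L]
  [Algebra E L] {P : Place k L} {p : Place k E}

theorem LiesOver.val_le_iff (h : P.LiesOver p) {a b : E} :
    P.val (algebraMap E L a) ≤ P.val (algebraMap E L b) ↔ p.val a ≤ p.val b := by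
  rcases eq_or_ne b 0 with rfl | hb
  · simp
  · have hb1 : 0 < p.val b := by simpa [zero_lt_iff] using hb
    have hb2 : 0 < P.val (algebraMap E L b) := by simpa [zero_lt_iff] using hb
    rw [← div_le_one₀ hb1, ← div_le_one₀ hb2, ← map_div₀, ← map_div₀, ← map_div₀, val_le_one_iff,
      val_le_one_iff, ← h]
    rfl

theorem LiesOver.val_eq_iff (h : P.LiesOver p) {a b : E} :
    P.val (algebraMap E L a) = P.val (algebraMap E L b) ↔ p.val a = p.val b := by
  rw [le_antisymm_iff, le_antisymm_iff, h.val_le_iff, h.val_le_iff]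

/-- A valuation ring of `L` dominates `O_p`; domination forces the intersection with `E` to be no
larger than `O_p`. -/
theorem exists_liesOver [IsScalarTower k E L] (p : Place k E) : ∃ P : Place k L, P.LiesOver p := by
  obtain ⟨A, hA, hloc⟩ := IsLocalRing.exists_factor_valuationRing
    ((algebraMap E L).comp p.ring.subtype)
  have hmem : ∀ a : E, algebraMap E L a ∈ A ↔ a ∈ p.ring := by
    intro a
    refine ⟨fun ha => ?_, fun ha => hA ⟨a, ha⟩⟩
    by_contra hap
    have ha0 : a ≠ 0 := by
      rintro rfl
      exact hap p.ring.zero_mem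
    have hinv := (p.ring.mem_or_inv_mem a).resolve_left hap
    have hu : IsUnit (⟨a⁻¹, hinv⟩ : p.ring) := by
      refine hloc.map_nonunit _ (isUnit_iff_exists_inv.2 ⟨⟨algebraMap E L a, ha⟩, Subtype.ext ?_⟩)
      change algebraMap E L a⁻¹ * algebraMap E L a = 1
      rw [← map_mul, inv_mul_cancel₀ ha0, map_one]
    obtain ⟨⟨b, hb⟩, hb'⟩ := isUnit_iff_exists_inv.1 hu
    have hb' : a⁻¹ * b = 1 := congr_arg Subtype.val hb'
    rw [inv_mul_eq_one₀ ha0] at hb'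
    exact hap (hb' ▸ hb)
  refine ⟨⟨A, fun c => ?_, fun htop => p.ne_top (eq_top_iff.2 fun a _ => ?_)⟩, ?_⟩
  · rw [IsScalarTower.algebraMap_apply k E L]
    exact (hmem _).2 (p.algebraMap_mem c)
  · exact (hmem a).1 (htop ▸ trivial)
  · exact ValuationSubring.ext _ _ hmem

end LiesOver

section Quadratic

variable {k L K : Type*} [Field k] [CharZero k] [Field L] [Field K] [Algebra k L] [Algebra k K]
  [Algebra L K] [IsScalarTower k L K]

/-- A place ramifies in the quadratic extension generated by a square root of `f` if and only if
`f` has odd order there. -/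
theorem mem_branchPlaces_sqrt_iff {f : L} (hf : f ≠ 0) {y : K} (hy : y ^ 2 = algebraMap L K f)
    (hgen : ∀ w : K, ∃ a b : L, w = algebraMap L K a + algebraMap L K b * y) (p : Place k L) :
    p ∈ branchPlaces k L K ↔ ∀ h, p.val f ≠ p.val h ^ 2 := by
  constructor
  · rintro ⟨P, hPp, hP⟩ h hfh
    -- Here `y` has the value of `h`, and every value of `a + b y` has to be found in `L`.
    refine hP ((ramificationIndex_eq_one_iff P).2 fun w hw => ?_)
    have hh : h ≠ 0 := by
      rintro rfl
      simp [hf] at hfh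
    have hh' : algebraMap L K h ≠ 0 := by simpa using hh
    obtain ⟨a, b, rfl⟩ := hgen w
    rw [← map_pow, ← hPp.val_eq_iff, ← hy, map_pow, map_pow, map_pow,
      pow_left_inj₀ zero_le zero_le two_ne_zero] at hfh
    -- the summand `b * y` has the same value as `b * h`
    have hby : P.val (algebraMap L K b * y) = P.val (algebraMap L K (b * h)) := by
      rw [map_mul, map_mul, map_mul, hfh]
    rcases lt_trichotomy (P.val (algebraMap L K a)) (P.val (algebraMap L K b * y)) with
      hlt | heq | hlt
    · exact ⟨b * h, by rw [Valuation.map_add_eq_of_lt_right _ hlt, hby]⟩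
    · by_cases hadd : P.val (algebraMap L K a + algebraMap L K b * y) =
        P.val (algebraMap L K a)
      · exact ⟨a, hadd.symm⟩
      have hadd' : P.val (algebraMap L K a + algebraMap L K b * y) < P.val (algebraMap L K a) :=
        lt_of_le_of_ne (P.val.map_add_le le_rfl heq.ge) hadd
      -- When `a + b y` cancels, its conjugate cannot, as their sum is `2a`. So the norm `a² - b² f`
      -- has the value of `(a + b y) a`.
      have hsub : P.val (algebraMap L K a - algebraMap L K b * y) = P.val (algebraMap L K a) := by
        refine le_antisymm (P.val.map_sub_le le_rfl heq.ge) ?_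
        by_contra! hsub
        have h2 := P.val.map_add_lt hadd' hsub
        have h3 : algebraMap L K a + algebraMap L K b * y +
            (algebraMap L K a - algebraMap L K b * y) = algebraMap k K 2 * algebraMap L K a := by
          rw [map_ofNat]
          ring
        rw [h3, map_mul, P.val_algebraMap two_ne_zero, one_mul] at h2
        exact h2.false
      have ha0 : a ≠ 0 := by
        rintro rfl
        simp at hadd'
      refine ⟨(a ^ 2 - b ^ 2 * f) / a, ?_⟩
      have ha0' : P.val (algebraMap L K a) ≠ 0 := by simpa using ha0
      rw [map_div₀, map_div₀, div_eq_iff ha0', ← hsub, ← map_mul]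
      congr 1
      rw [map_sub, map_mul, map_pow, map_pow, ← hy]
      ring
    · exact ⟨a, by rw [Valuation.map_add_eq_of_lt_left _ hlt]⟩
  · intro h
    obtain ⟨P, hP⟩ := exists_liesOver (L := K) p
    refine ⟨P, hP, fun hP1 => ?_⟩
    have hy0 : y ≠ 0 := by
      rintro rfl
      rw [zero_pow two_ne_zero, eq_comm, map_eq_zero] at hy
      exact hf hy
    obtain ⟨a, ha⟩ := (ramificationIndex_eq_one_iff P).1 hP1 y hy0
    apply h a
    rw [← map_pow, ← hP.val_eq_iff, ← hy, map_pow, map_pow, map_pow, ha]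

end Quadratic

end Place

end

/-! ### Places of odd order -/

section

open Polynomial IntermediateField

namespace Place

variable {k L : Type*} [Field k] [Field L] [Algebra k L]

/-- The function `f` has odd order at the place `p`. -/
def IsOdd (p : Place k L) (f : L) : Prop := ∀ h, p.val f ≠ p.val h ^ 2

theorem IsOdd.sq_mul {p : Place k L} {f : L} (hf : p.IsOdd f) {c : L} (hc : c ≠ 0) :
    p.IsOdd (c ^ 2 * f) := by
  intro h hh
  apply hf (h / c)
  have hc' : p.val c ≠ 0 := by simpa using hc
  rw [map_div₀, div_pow, ← hh, map_mul, map_pow, mul_div_cancel_left₀ _ (pow_ne_zero 2 hc')]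

theorem isOdd_sq_mul_iff {p : Place k L} {f c : L} (hc : c ≠ 0) :
    p.IsOdd (c ^ 2 * f) ↔ p.IsOdd f := by
  refine ⟨fun h => ?_, fun h => h.sq_mul hc⟩
  have h' := h.sq_mul (inv_ne_zero hc)
  rwa [← mul_assoc, ← mul_pow, inv_mul_cancel₀ hc, one_pow, one_mul] at h'

theorem isOdd_smul_map_iff {p : Place k L} {f : L} (g : L ≃ₐ[k] L) :
    (g • p).IsOdd (g f) ↔ p.IsOdd f := by
  have key : ∀ h, (g • p).val (g f) = (g • p).val (g h) ^ 2 ↔ p.val f = p.val h ^ 2 := by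
    intro h
    rw [← map_pow, ← map_pow, ← map_pow, val_smul_map_eq_iff]
  constructor
  · exact fun H h hh => H (g h) ((key h).2 hh)
  · intro H h hh
    exact H (g.symm h) ((key _).1 (by simpa using hh))

/-- All nonzero values are powers of that of `t`, and `1 = 2n` has no integer solution. -/
theorem isOdd_coordinate (p : Place k L) {t : L} (ht : IsCoordinate k t) (hpt : p.val t < 1) :
    p.IsOdd t := by
  intro h hh
  have h0 : h ≠ 0 := by
    rintro rfl
    simp [ht.ne_zero] at hh
  obtain ⟨n, hn⟩ := p.exists_val_eq_zpow ht hpt h0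
  rw [hn, ← zpow_natCast, ← zpow_mul] at hh
  nth_rewrite 1 [← zpow_one (p.val t)] at hh
  have := zpow_right_injective₀ (p.val_pos_of_isCoordinate ht) hpt.ne hh
  push_cast at this
  omega

theorem val_aeval_eq_one_of_eval_ne_zero (p : Place k L) {x : L} {c : k}
    (hc : p.val (x - algebraMap k L c) < 1) {P : k[X]} (hP : P.eval c ≠ 0) :
    p.val (aeval x P) = 1 := by
  have h := p.val_aeval_eq_one hc (P := P.comp (X + C c)) (by
    rwa [coeff_zero_eq_eval_zero, eval_comp, eval_add, eval_X, eval_C, zero_add])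
  rwa [aeval_comp, map_add, aeval_X, aeval_C, sub_add_cancel] at h

theorem isOdd_aeval_of_isRoot (p : Place k L) {x : L} (hx : IsCoordinate k x) {c : k}
    (hc : p.val (x - algebraMap k L c) < 1) {F : k[X]} (hF : Squarefree F) (hFc : F.IsRoot c) :
    p.IsOdd (aeval x F) := by
  obtain ⟨R, rfl⟩ := dvd_iff_isRoot.2 hFc
  have hR : R.eval c ≠ 0 := by
    intro hR
    obtain ⟨S, rfl⟩ := dvd_iff_isRoot.2 hR
    exact not_isUnit_X_sub_C c (hF _ ⟨S, by ring⟩)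
  intro h
  rw [map_mul, map_mul, p.val_aeval_eq_one_of_eval_ne_zero hc hR, mul_one, map_sub, aeval_X,
    aeval_C]
  exact p.isOdd_coordinate (hx.sub_algebraMap c) hc h

variable [IsAlgClosed k]

/-- At finite places the roots of `F` are simple; at infinity the pole of `F(x)` has order `deg F`,
which is even. -/
theorem isOdd_aeval_iff (p : Place k L) {x : L} (hx : IsCoordinate k x) {F : k[X]}
    (hF : Squarefree F) (heven : Even F.natDegree) :
    p.IsOdd (aeval x F) ↔ ∃ c, F.IsRoot c ∧ p.val (x - algebraMap k L c) < 1 := by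
  refine ⟨fun hodd => ?_, fun ⟨c, hFc, hc⟩ => p.isOdd_aeval_of_isRoot hx hc hF hFc⟩
  by_cases hpx : p.val x ≤ 1
  · obtain ⟨c, hc⟩ := p.exists_val_sub_algebraMap_lt_one hx hpx
    refine ⟨c, ?_, hc⟩
    by_contra hFc
    exact hodd 1 (by rw [p.val_aeval_eq_one_of_eval_ne_zero hc hFc, map_one, one_pow])
  · exfalso
    have hpx' : p.val x⁻¹ < 1 := by
      rw [map_inv₀]
      exact inv_lt_one_of_one_lt₀ (not_le.1 hpx)
    have h := p.val_aeval_inv hx.inv.ne_zero hpx' hF.ne_zero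
    obtain ⟨m, hm⟩ := heven
    rw [inv_inv, hm, ← two_mul, mul_comm, pow_mul] at h
    exact hodd (x ^ m) (by rw [h, map_pow])

theorem encard_isOdd_aeval [CharZero k] {x : L} (hx : IsCoordinate k x) {F : k[X]}
    (hF : Squarefree F) (heven : Even F.natDegree) :
    {p : Place k L | p.IsOdd (aeval x F)}.encard = F.natDegree := by
  classical
  choose pl hpl using fun c : k => exists_val_lt_one (hx.sub_algebraMap c)
  have hinj : Function.Injective pl := by
    intro c d hcd
    have h := (pl c).val.map_sub_lt (hpl c) (hcd ▸ hpl d)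
    rw [sub_sub_sub_cancel_left, ← map_sub, val_algebraMap_lt_one_iff, sub_eq_zero] at h
    exact h.symm
  have hset : {p : Place k L | p.IsOdd (aeval x F)} = pl '' (F.roots.toFinset : Set k) := by
    ext p
    rw [Set.mem_ofPred_eq, isOdd_aeval_iff p hx hF heven]
    simp only [Set.mem_image, Finset.mem_coe, Multiset.mem_toFinset, mem_roots hF.ne_zero]
    refine exists_congr fun c => and_congr_right fun _ => ⟨fun h => ?_, fun h => h ▸ hpl c⟩
    exact eq_of_isCoordinate (hx.sub_algebraMap c) (hpl c) h
  rw [hset, hinj.encard_image, Set.encard_coe_eq_coe_finsetCard,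
    Multiset.toFinset_card_of_nodup (nodup_roots (PerfectField.separable_iff_squarefree.2 hF)),
    (splits_iff_card_roots.1 (IsAlgClosed.splits F))]

end Place

end

/-! ### Values at fixed places, and the sign attached to a lifted involution -/

section

open Polynomial IntermediateField

namespace Place

variable {k L : Type*} [Field k] [Field L] [Algebra k L]

/-- The function `f` is regular at `p`, with value `c`. -/
def HasValue (p : Place k L) (f : L) (c : k) : Prop := p.val (f - algebraMap k L c) < 1

theorem HasValue.le_one {p : Place k L} {f : L} {c : k} (h : p.HasValue f c) : p.val f ≤ 1 := by
  have := p.val.map_add_le (le_of_lt h) (p.val_algebraMap_le c)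
  rwa [sub_add_cancel] at this

theorem hasValue_algebraMap (p : Place k L) (c : k) : p.HasValue (algebraMap k L c) c := by
  simp [HasValue]

theorem HasValue.mul {p : Place k L} {f g : L} {c d : k} (hf : p.HasValue f c)
    (hg : p.HasValue g d) : p.HasValue (f * g) (c * d) := by
  have h : f * g - algebraMap k L (c * d) =
      (f - algebraMap k L c) * g + algebraMap k L c * (g - algebraMap k L d) := by
    rw [map_mul]
    ring
  rw [HasValue, h]
  refine p.val.map_add_lt ?_ ?_ <;> rw [map_mul]
  · exact mul_lt_one_of_nonneg_of_lt_one_left zero_le hf hg.le_one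
  · exact mul_lt_one_of_nonneg_of_lt_one_right (p.val_algebraMap_le c) zero_le hg

theorem HasValue.inv {p : Place k L} {f : L} {c : k} (hf : p.HasValue f c) (hc : c ≠ 0) :
    p.HasValue f⁻¹ c⁻¹ := by
  have h1 : p.val f = 1 := p.val_eq_one_of_sub_lt hc hf
  have hf0 : f ≠ 0 := by
    rintro rfl
    simp at h1
  have hc' : algebraMap k L c ≠ 0 := by simpa using hc
  have h : f⁻¹ - algebraMap k L c⁻¹ = -(f - algebraMap k L c) / (f * algebraMap k L c) := by
    rw [map_inv₀]
    field_simp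
    ring
  rw [HasValue, h, map_div₀, map_mul, h1, p.val_algebraMap hc, Valuation.map_neg, mul_one, div_one]
  exact hf

theorem HasValue.pow {p : Place k L} {f : L} {c : k} (hf : p.HasValue f c) (n : ℕ) :
    p.HasValue (f ^ n) (c ^ n) := by
  induction n with
  | zero => simpa using p.hasValue_algebraMap 1
  | succ n ih => simpa only [pow_succ] using ih.mul hf

theorem HasValue.zpow {p : Place k L} {f : L} {c : k} (hf : p.HasValue f c) (hc : c ≠ 0) (n : ℤ) :
    p.HasValue (f ^ n) (c ^ n) := by
  obtain ⟨m, rfl | rfl⟩ := n.eq_nat_or_neg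
  · simpa using hf.pow m
  · simpa using (hf.pow m).inv (pow_ne_zero m hc)

theorem HasValue.unique {p : Place k L} {f : L} {c d : k} (hc : p.HasValue f c)
    (hd : p.HasValue f d) : c = d := by
  have h := p.val.map_sub_lt hc hd
  rw [sub_sub_sub_cancel_left, ← map_sub, val_algebraMap_lt_one_iff, sub_eq_zero] at h
  exact h.symm

theorem HasValue.map {p : Place k L} {f : L} {c : k} (hf : p.HasValue f c) {g : L ≃ₐ[k] L}
    (hg : g • p = p) : p.HasValue (g f) c := by
  have h := (val_map_lt_one_iff hg).2 hf
  rwa [map_sub, AlgEquiv.commutes] at h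

variable [IsAlgClosed k] [CharZero k]

/-- If the involution `s` of the line fixes `p` and multiplies `f` by the square of `c`, then the
norm of `c` is the sign given by the parity of the order of `f` at `p`. -/
theorem map_mul_self_of_involution {x : L} (hx : IsCoordinate k x) {p : Place k L} {s : L ≃ₐ[k] L}
    (hs : s * s = 1) (hs1 : s ≠ 1) (hp : s • p = p) {f c : L} (hf : f ≠ 0)
    (hfc : s f = c ^ 2 * f) :
    (p.IsOdd f → s c * c = -1) ∧ (¬ p.IsOdd f → s c * c = 1) := by
  have hss : ∀ f, s (s f) = f := fun f => by rw [← AlgEquiv.mul_apply, hs, AlgEquiv.one_apply]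
  -- Applying `s` twice to `f` gives `(s c * c)² = 1`.
  have hsc : s c * c = 1 ∨ s c * c = -1 := by
    rw [← sq_eq_one_iff]
    have h := congr_arg s hfc
    rw [hss, map_mul, map_pow, hfc, ← mul_assoc, ← mul_pow] at h
    exact (mul_eq_right₀ hf).1 h.symm
  have hscv : p.val (s c * c) = 1 := by
    rcases hsc with h | h <;> simp [h]
  have hcv : p.val c ≤ 1 := by
    by_contra! h
    have hc0 : c ≠ 0 := by
      rintro rfl
      simp at h
    have h1 : p.val c⁻¹ < 1 := by
      rw [map_inv₀]
      exact inv_lt_one_of_one_lt₀ h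
    have h2 := mul_lt_one_of_nonneg_of_lt_one_left zero_le ((val_map_lt_one_iff hp).2 h1) h1.le
    rw [← map_mul, map_inv₀, ← mul_inv, map_inv₀, hscv, inv_one] at h2
    exact h2.false
  obtain ⟨d, hd⟩ : ∃ d, p.HasValue c d := p.exists_val_sub_algebraMap_lt_one hx hcv
  obtain ⟨t, ht, hpt⟩ := p.exists_isCoordinate hx
  have ht0 := p.val_pos_of_isCoordinate ht
  have hst : p.HasValue (s t / t) (-1) := by
    have h := (hasMultiplier_neg_one_of_involution hx hs hs1 hp).2 t ht hpt
    rw [HasValue, ← mul_lt_iff_lt_one_left ht0, ← map_mul, sub_mul, div_mul_cancel₀ _ ht.ne_zero]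
    exact h
  obtain ⟨n, hn⟩ := p.exists_val_eq_zpow ht hpt hf
  have hu1 : p.val (f / t ^ n) = 1 := by
    rw [map_div₀, hn, map_zpow₀, div_self (zpow_ne_zero n ht0.ne')]
  obtain ⟨e, he⟩ : ∃ e, p.HasValue (f / t ^ n) e := p.exists_val_sub_algebraMap_lt_one hx hu1.le
  have he0 : e ≠ 0 := by
    rintro rfl
    rw [HasValue, map_zero, sub_zero, hu1] at he
    exact he.false
  -- Write `f = tⁿ u` with `u` a unit. Then `c² = s f / f`; the value of `u` cancels, and `s t / t`
  -- has value `-1`.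
  have key : p.HasValue (c ^ 2) ((-1) ^ n) := by
    have h := (hst.zpow (neg_ne_zero.2 one_ne_zero) n).mul ((he.map hp).mul (he.inv he0))
    rw [mul_inv_cancel₀ he0, mul_one] at h
    convert h using 1
    rw [map_div₀, hfc, map_zpow₀, div_zpow]
    have := ht.ne_zero
    have := (ht.map s).ne_zero
    field_simp
  have hd2 := (hd.pow 2).unique key
  -- Since `s` fixes `p`, `s c` and `c` have the same value there, so the sign `s c * c` is the
  -- value of `c²`.
  have hval : p.HasValue (s c * c) ((-1) ^ n) := by
    rw [← hd2, sq]
    exact (hd.map hp).mul hd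
  have hodd : p.IsOdd f ↔ Odd n := by
    constructor
    · intro h
      by_contra hn'
      obtain ⟨m, hm⟩ := Int.not_odd_iff_even.1 hn'
      refine h (t ^ m) ?_
      rw [hn, hm, map_zpow₀, ← zpow_natCast, ← zpow_mul]
      congr 1
      push_cast
      ring
    · rintro ⟨m, hm⟩ h hh
      refine p.isOdd_coordinate ht hpt (h / t ^ m) ?_
      rw [map_div₀, div_pow, ← hh, hn, hm, map_zpow₀, ← zpow_natCast, ← zpow_mul,
        eq_div_iff (zpow_ne_zero _ ht0.ne'), zpow_add₀ ht0.ne', zpow_one, mul_comm]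
      congr 2
      push_cast
      ring
  have h2 : (-1 : k) ≠ 1 := by norm_num
  constructor
  · intro h
    rw [(hodd.1 h).neg_one_zpow] at hval
    refine hsc.resolve_left fun h1 => h2 ?_
    rw [h1] at hval
    exact hval.unique (by simpa using p.hasValue_algebraMap 1)
  · intro h
    rw [hodd, Int.not_odd_iff_even] at h
    rw [h.neg_one_zpow] at hval
    refine hsc.resolve_right fun h1 => h2 ?_
    rw [h1] at hval
    exact HasValue.unique (f := (-1 : L)) (by simpa using p.hasValue_algebraMap (-1)) hval

end Place

end

/-! ### Polynomial relations of bounded bidegree -/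

section

open Polynomial IntermediateField

namespace Polynomial.Bivariate

theorem coeff_coeff_swap {R : Type*} [CommSemiring R] (P : R[X][X]) (i j : ℕ) :
    ((swap P).coeff i).coeff j = (P.coeff j).coeff i := by
  induction P using Polynomial.induction_on' with
  | add p q hp hq => simp only [map_add, coeff_add, hp, hq]
  | monomial n a =>
    induction a using Polynomial.induction_on' with
    | add p q hp hq => simp only [map_add, coeff_add, hp, hq]
    | monomial m r =>
      rw [swap_monomial_monomial]
      simp only [coeff_monomial]
      split_ifs <;> simp_all [coeff_monomial]

theorem natDegree_coeff_le_natDegree_swap {R : Type*} [CommSemiring R] (P : R[X][X]) (j : ℕ) :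
    (P.coeff j).natDegree ≤ (swap P).natDegree := by
  refine natDegree_le_iff_coeff_eq_zero.2 fun i hi => ?_
  rw [← coeff_coeff_swap, coeff_eq_zero_of_natDegree_lt hi, coeff_zero]

end Polynomial.Bivariate

section Bidegree

variable {k K : Type*} [Field k] [Field K] [Algebra k K]

/-- By Gauss's lemma `P` stays irreducible over `k(x)` when its degree is positive, so it is
proportional to the minimal polynomial of `u`, which divides `R`. -/
theorem natDegree_le_of_aevalAeval_eq_zero {x u : K} (hx : Transcendental k x) {P R : k[X][X]}
    (hP : Irreducible P) (hPu : aevalAeval x u P = 0) (hR : R ≠ 0) (hRu : aevalAeval x u R = 0) :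
    P.natDegree ≤ R.natDegree := by
  rcases eq_or_ne P.natDegree 0 with h0 | h0
  · omega
  have hinj : Function.Injective (aeval x : k[X] →ₐ[k] K).toRingHom :=
    transcendental_iff_injective.1 hx
  let φ : FractionRing k[X] →+* K := IsFractionRing.lift hinj
  let _ := φ.toAlgebra
  have hφ : ∀ Q : k[X][X], aeval u (Q.map (algebraMap k[X] (FractionRing k[X]))) =
      aevalAeval x u Q := by
    intro Q
    have h : φ.comp (algebraMap k[X] (FractionRing k[X])) = (aeval x : k[X] →ₐ[k] K).toRingHom :=
      RingHom.ext fun a => IsFractionRing.lift_algebraMap hinj a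
    rw [aeval_def, eval₂_map, RingHom.algebraMap_toAlgebra, h]
    induction Q using Polynomial.induction_on' with
    | add p q hp hq => rw [eval₂_add, hp, hq, map_add]
    | monomial n a =>
      rw [eval₂_monomial, ← C_mul_X_pow_eq_monomial, map_mul, map_pow, aevalAeval_C, aevalAeval_Y]
      rfl
  have hmapinj : Function.Injective (algebraMap k[X] (FractionRing k[X])) :=
    IsFractionRing.injective _ _
  have hirr := ((hP.isPrimitive h0).irreducible_iff_irreducible_map_fraction_map
    (K := FractionRing k[X])).1 hP
  have hmin := minpoly.eq_of_irreducible hirr (x := u) (by rw [hφ, hPu])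
  have hdvd := minpoly.dvd (FractionRing k[X]) u (p := R.map (algebraMap k[X] (FractionRing k[X])))
    (by rw [hφ, hRu])
  have hle := natDegree_le_of_dvd hdvd (by rwa [Ne, Polynomial.map_eq_zero_iff hmapinj])
  rw [← hmin, natDegree_mul_C (inv_ne_zero (leadingCoeff_ne_zero.2 hirr.ne_zero)),
    natDegree_map_eq_of_injective hmapinj, natDegree_map_eq_of_injective hmapinj] at hle
  exact hle

/-- The kernel of evaluation at `(x, u)` is a prime ideal. A prime element in it has degree at most
2 in each variable, by comparison with `R` and, after swapping, with `R'`. -/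
theorem exists_quadratic_relation {x u : K} (hx : Transcendental k x) (hu : Transcendental k u)
    {R R' : k[X][X]} (hR : R ≠ 0) (hRu : aevalAeval x u R = 0) (hR2 : R.natDegree ≤ 2)
    (hR' : R' ≠ 0) (hRx : aevalAeval u x R' = 0) (hR2' : R'.natDegree ≤ 2) :
    ∃ a b c : k[X], a.natDegree ≤ 2 ∧ b.natDegree ≤ 2 ∧ c.natDegree ≤ 2 ∧
      ¬ (a = 0 ∧ b = 0 ∧ c = 0) ∧ aeval x a * u ^ 2 + aeval x b * u + aeval x c = 0 := by
  obtain ⟨P, hPu, hP⟩ := (RingHom.ker_isPrime (aevalAeval x u : k[X][X] →ₐ[k] K)).exists_mem_prime_of_ne_bot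
    (fun h => hR (by rw [← Ideal.mem_bot, ← h]; exact hRu))
  have hPu : aevalAeval x u P = 0 := hPu
  have h1 := (natDegree_le_of_aevalAeval_eq_zero hx hP.irreducible hPu hR hRu).trans hR2
  have hswap : Irreducible (Bivariate.swap P) :=
    (MulEquiv.irreducible_iff (Bivariate.swap (R := k))).2 hP.irreducible
  have h2 := (natDegree_le_of_aevalAeval_eq_zero hu hswap
    (by rw [Bivariate.aevalAeval_swap, hPu]) hR' hRx).trans hR2'
  have hc := fun j => (Bivariate.natDegree_coeff_le_natDegree_swap P j).trans h2
  have hPe := P.as_sum_range' 3 (by omega)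
  simp only [Finset.sum_range_succ, Finset.sum_range_zero, zero_add] at hPe
  refine ⟨P.coeff 2, P.coeff 1, P.coeff 0, hc 2, hc 1, hc 0, ?_, ?_⟩
  · rintro ⟨h2, h1, h0⟩
    rw [h0, h1, h2] at hPe
    exact hP.ne_zero (by simpa using hPe)
  · rw [hPe] at hPu
    simp only [map_add, ← C_mul_X_pow_eq_monomial, map_mul, map_pow, aevalAeval_C,
      aevalAeval_Y] at hPu
    linear_combination hPu

end Bidegree

end

/-! ### Uniqueness of the hyperelliptic map -/

section

open Polynomial IntermediateField

/-- `K = L(y)` is the function field of `y ^ 2 = F(x)` over the function field `L = k(x)` of the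
line, with `F` squarefree of even degree at least six. -/
structure IsHyperellipticExtension (k : Type*) {L K : Type*} [Field k] [Field L] [Field K]
    [Algebra k L] [Algebra L K] (x : L) (F : k[X]) (y : K) : Prop where
  isCoordinate : IsCoordinate k x
  squarefree : Squarefree F
  even_natDegree : Even F.natDegree
  six_le_natDegree : 6 ≤ F.natDegree
  sq_eq : y ^ 2 = algebraMap L K (aeval x F)
  exists_eq_add : ∀ w : K, ∃ a b : L, w = algebraMap L K a + algebraMap L K b * y

namespace IsHyperellipticExtension

variable {k L K : Type*} [Field k] [Field L] [Field K] [Algebra k L] [Algebra L K]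
  {x : L} {F : k[X]} {y : K}

theorem aeval_ne_zero (H : IsHyperellipticExtension k x F y) : aeval x F ≠ 0 :=
  H.isCoordinate.aeval_ne_zero H.squarefree.ne_zero

/-- At a root of `F` the function `F(x)` has odd order, so it is not a square in `L`. -/
theorem notMem_range [IsAlgClosed k] (H : IsHyperellipticExtension k x F y) (a : L) : algebraMap L K a ≠ y := by
  rintro rfl
  obtain ⟨c, hc⟩ := IsAlgClosed.exists_root F
    (fun h => by have := H.six_le_natDegree; rw [natDegree_eq_zero_iff_degree_le_zero.2 h.le] at this; omega)
  obtain ⟨p, hp⟩ := Place.exists_val_lt_one (H.isCoordinate.sub_algebraMap c)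
  refine p.isOdd_aeval_of_isRoot H.isCoordinate hp H.squarefree hc a ?_
  have := H.sq_eq
  rw [← map_pow] at this
  rw [← map_pow, (algebraMap L K).injective this]

theorem eq_zero_of_mul_mem [IsAlgClosed k] (H : IsHyperellipticExtension k x F y) {a b : L}
    (h : algebraMap L K b * y = algebraMap L K a) : b = 0 := by
  by_contra hb
  refine H.notMem_range (a / b) ?_
  rw [map_div₀, ← h, mul_div_cancel_left₀]
  simpa using hb

variable [Algebra k K] [IsScalarTower k L K]

theorem exists_aevalAeval_eq_zero (H : IsHyperellipticExtension k x F y) (w : K) :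
    ∃ R : k[X][X], R ≠ 0 ∧ aevalAeval (algebraMap L K x) w R = 0 ∧ R.natDegree ≤ 2 := by
  obtain ⟨A, B, rfl⟩ := H.exists_eq_add w
  obtain ⟨a, d, hd, rfl⟩ := H.isCoordinate.exists_eq_div A
  obtain ⟨b, e, he, rfl⟩ := H.isCoordinate.exists_eq_div B
  have hde : d * e ≠ 0 := mul_ne_zero hd he
  -- For `w = A + B y` this is `T² - 2AT + A² - B²F`, with the denominators of `A = a/d` and `B =
  -- b/e` cleared by `(de)²`.
  refine ⟨C ((d * e) ^ 2) * X ^ 2 + C (-2 * (a * e) * (d * e)) * X +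
    C ((a * e) ^ 2 - (b * d) ^ 2 * F), fun h => ?_, ?_, natDegree_quadratic_le⟩
  · have := natDegree_quadratic (pow_ne_zero 2 hde) (b := -2 * (a * e) * (d * e))
      (c := (a * e) ^ 2 - (b * d) ^ 2 * F)
    rw [h, natDegree_zero] at this
    omega
  · have hd' := H.isCoordinate.aeval_ne_zero hd
    have he' := H.isCoordinate.aeval_ne_zero he
    have hd'' : algebraMap L K (aeval x d) ≠ 0 := by simpa using hd'
    have he'' : algebraMap L K (aeval x e) ≠ 0 := by simpa using he'
    simp only [map_add, map_mul, map_pow, aevalAeval_C, aevalAeval_Y, aeval_algebraMap_apply,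
      map_sub, map_div₀, map_neg, map_ofNat, ← H.sq_eq]
    field_simp
    ring

/-- The function field of the line is preserved by all automorphisms: the hyperelliptic map is
unique. -/
theorem exists_map_eq [IsAlgClosed k] [CharZero k] (H : IsHyperellipticExtension k x F y) (σ : K ≃ₐ[k] K) :
    ∃ a : L, σ (algebraMap L K x) = algebraMap L K a := by
  by_contra! hσ
  have hx : Transcendental k (algebraMap L K x) := fun h => H.isCoordinate.transcendental
    ((isAlgebraic_algebraMap_iff (algebraMap L K).injective).1 h)
  have hu : Transcendental k (σ (algebraMap L K x)) := fun h => hx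
    ((isAlgebraic_algHom_iff σ.toAlgHom σ.injective).1 h)
  set u := σ (algebraMap L K x) with hu_def
  obtain ⟨R, hR, hRu, hR2⟩ := H.exists_aevalAeval_eq_zero u
  obtain ⟨R', hR', hRx, hR2'⟩ := H.exists_aevalAeval_eq_zero (σ.symm (algebraMap L K x))
  -- The relation between `x` and `σ⁻¹ x`, transported by `σ`, bounds the degree of `x` over `k(u)`.
  have hRx' : aevalAeval u (algebraMap L K x) R' = 0 := by
    have h := congr_arg σ hRx
    rw [map_zero] at h
    rw [← h, hu_def]
    have : (aevalAeval (σ (algebraMap L K x)) (algebraMap L K x) : k[X][X] →ₐ[k] K) =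
        σ.toAlgHom.comp (aevalAeval (algebraMap L K x) (σ.symm (algebraMap L K x))) := by
      apply (aevalAevalEquiv k K).symm.injective
      ext <;> simp [aevalAevalEquiv]
    rw [this]
    rfl
  obtain ⟨a, b, c, ha2, hb2, hc2, hne, habc⟩ :=
    exists_quadratic_relation hx hu hR hRu hR2 hR' hRx' hR2'
  simp only [aeval_algebraMap_apply] at habc
  have haz : ∀ P : k[X], algebraMap L K (aeval x P) = 0 → P = 0 := by
    intro P hP
    by_contra h
    exact H.isCoordinate.aeval_ne_zero h (by simpa using hP)
  -- If `a = 0`, the relation is linear in `u` and puts `u` in `L`.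
  have ha : a ≠ 0 := by
    rintro rfl
    have hb : b ≠ 0 := by
      rintro rfl
      exact hne ⟨rfl, rfl, haz c (by simpa using habc)⟩
    have hb' : algebraMap L K (aeval x b) ≠ 0 := fun h => hb (haz b h)
    refine hσ (-aeval x c / aeval x b) ?_
    rw [map_div₀, map_neg, eq_div_iff hb']
    simp only [map_zero, zero_mul, zero_add] at habc
    linear_combination habc
  set D := b ^ 2 - 4 * a * c with hD
  obtain ⟨A, B, hAB⟩ := H.exists_eq_add u
  have hB : B ≠ 0 := by
    rintro rfl
    exact hσ A (by simpa using hAB)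
  -- `z = 2 a u + b = A' + B' y` is a square root of the discriminant
  have hz : (algebraMap L K (2 * aeval x a * A + aeval x b) +
      algebraMap L K (2 * aeval x a * B) * y) ^ 2 = algebraMap L K (aeval x D) := by
    simp only [hD, map_sub, map_mul, map_pow, map_add, map_ofNat]
    rw [hAB] at habc
    linear_combination 4 * algebraMap L K (aeval x a) * habc
  have : CharZero L := charZero_of_injective_algebraMap (algebraMap k L).injective
  have haL : aeval x a ≠ 0 := H.isCoordinate.aeval_ne_zero ha
  have hB' : 2 * aeval x a * B ≠ 0 := mul_ne_zero (mul_ne_zero two_ne_zero haL) hB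
  set A' := 2 * aeval x a * A + aeval x b
  set B' := 2 * aeval x a * B
  -- The square of `A' + B' y` lies in `L`, so its cross term `2 A' B' y` vanishes.
  have hA' : A' = 0 := by
    have h := H.eq_zero_of_mul_mem (b := 2 * A' * B')
      (a := aeval x D - A' ^ 2 - B' ^ 2 * aeval x F) (by
        simp only [map_sub, map_mul, map_pow, map_ofNat, ← H.sq_eq]
        linear_combination hz)
    simpa [hB'] using h
  have hDF : aeval x D = B' ^ 2 * aeval x F := by
    apply (algebraMap L K).injective
    rw [← hz, hA', map_zero, zero_add, mul_pow, H.sq_eq, ← map_pow, ← map_mul]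
  have hD0 : D ≠ 0 := by
    intro h
    rw [h, map_zero, eq_comm] at hDF
    exact mul_ne_zero (pow_ne_zero 2 hB') H.aeval_ne_zero hDF
  -- `D` is `F` times a square, so it has odd order, and hence a zero, at each of the at least six
  -- roots of `F`; its degree is at most 4.
  have hsub : F.roots ⊆ D.roots := by
    intro c hc
    rw [mem_roots H.squarefree.ne_zero] at hc
    rw [mem_roots hD0]
    by_contra hDc
    obtain ⟨p, hp⟩ := Place.exists_val_lt_one (H.isCoordinate.sub_algebraMap c)
    have h := (p.isOdd_aeval_of_isRoot H.isCoordinate hp H.squarefree hc).sq_mul hB'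
    rw [← hDF] at h
    exact h 1 (by rw [p.val_aeval_eq_one_of_eval_ne_zero hp hDc, map_one, one_pow])
  have hnodup : F.roots.Nodup := nodup_roots (PerfectField.separable_iff_squarefree.2 H.squarefree)
  have hcard := Multiset.card_le_card ((Multiset.le_iff_subset hnodup).2 hsub)
  rw [splits_iff_card_roots.1 (IsAlgClosed.splits F)] at hcard
  have hDdeg : D.natDegree ≤ 4 := by
    rw [hD]
    compute_degree
    · omega
  have := H.six_le_natDegree
  have := D.card_roots'
  omega

end IsHyperellipticExtension

end

/-! ### The action of the automorphism group on the line -/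

section

open Polynomial IntermediateField

/-- Restriction of automorphisms to an intermediate field that all of them preserve. -/
def IntermediateField.restrictAut {k K : Type*} [Field k] [Field K] [Algebra k K]
    (L : IntermediateField k K) (h : ∀ (σ : K ≃ₐ[k] K) (a : L), σ a ∈ L) :
    (K ≃ₐ[k] K) →* (L ≃ₐ[k] L) where
  toFun σ :=
    { toFun := fun a => ⟨σ a, h σ a⟩
      invFun := fun a => ⟨σ.symm a, h σ.symm a⟩
      left_inv := fun a => by simp
      right_inv := fun a => by simp
      map_mul' := fun a b => by ext; simp
      map_add' := fun a b => by ext; simp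
      commutes' := fun c => by ext; simp }
  map_one' := by ext; rfl
  map_mul' σ τ := by ext; rfl

namespace IsHyperellipticExtension

variable {k K : Type*} [Field k] [Field K] [Algebra k K] {L : IntermediateField k K}
  {x : L} {F : k[X]} {y : K} [IsAlgClosed k]

theorem finrank_eq_two (H : IsHyperellipticExtension k x F y) : Module.finrank L K = 2 := by
  have hspan : Submodule.span L (Set.range ![(1 : K), y]) = ⊤ := by
    rw [eq_top_iff]
    rintro w -
    obtain ⟨a, b, rfl⟩ := H.exists_eq_add w
    rw [Matrix.range_cons, Matrix.range_cons, Matrix.range_empty, Set.union_empty,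
      Set.singleton_union, Submodule.mem_span_pair]
    exact ⟨a, b, by rw [Algebra.smul_def, Algebra.smul_def, mul_one]⟩
  have hli : LinearIndependent L ![(1 : K), y] := by
    rw [LinearIndependent.pair_iff]
    intro a b hab
    rw [Algebra.smul_def, Algebra.smul_def, mul_one] at hab
    have hb := H.eq_zero_of_mul_mem (b := b) (a := -a) (by
      rw [map_neg]
      linear_combination hab)
    rw [hb, map_zero, zero_mul, add_zero] at hab
    exact ⟨by simpa using hab, hb⟩
  have := Module.finrank_eq_card_basis (Module.Basis.mk hli hspan.ge)
  simpa using this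

variable [CharZero k]

theorem map_mem (H : IsHyperellipticExtension k x F y) (σ : K ≃ₐ[k] K) (a : L) : σ a ∈ L := by
  obtain ⟨b, hb⟩ := H.exists_map_eq σ
  obtain ⟨P, Q, -, rfl⟩ := H.isCoordinate.exists_eq_div a
  have hP : ∀ P : k[X], σ (aeval x P : L) ∈ L := by
    intro P
    have h1 : σ (aeval x P : L) = aeval (σ (x : K)) P := by
      change σ (algebraMap L K (aeval x P)) = _
      rw [← aeval_algebraMap_apply]
      exact (aeval_algHom_apply σ.toAlgHom _ _).symm
    rw [h1]
    change σ (x : K) = b at hb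
    rw [hb]
    change aeval (algebraMap L K b) P ∈ L
    rw [aeval_algebraMap_apply]
    exact (aeval b P).2
  rw [IntermediateField.coe_div, map_div₀]
  exact div_mem (hP P) (hP Q)

/-- The action of the automorphism group of the curve on the line. -/
noncomputable def lineAction (H : IsHyperellipticExtension k x F y) :
    (K ≃ₐ[k] K) →* (L ≃ₐ[k] L) :=
  L.restrictAut H.map_mem

theorem coe_lineAction (H : IsHyperellipticExtension k x F y) (σ : K ≃ₐ[k] K) (a : L) :
    (H.lineAction σ a : K) = σ a := rfl

theorem ker_lineAction (H : IsHyperellipticExtension k x F y) :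
    H.lineAction.ker = L.fixingSubgroup := by
  ext σ
  rw [MonoidHom.mem_ker, IntermediateField.mem_fixingSubgroup_iff]
  constructor
  · intro h a ha
    have := coe_lineAction H σ ⟨a, ha⟩
    rw [h] at this
    exact this.symm
  · intro h
    ext a
    exact h a a.2

theorem ext_of_apply (H : IsHyperellipticExtension k x F y) {σ τ : K ≃ₐ[k] K}
    (h : H.lineAction σ = H.lineAction τ) (hy : σ y = τ y) : σ = τ := by
  have hL : ∀ a : L, σ a = τ a := fun a => by rw [← coe_lineAction H, h, coe_lineAction]
  ext w
  obtain ⟨a, b, rfl⟩ := H.exists_eq_add w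
  rw [map_add, map_add, map_mul, map_mul, hy]
  change σ a + σ b * _ = τ a + τ b * _
  rw [hL, hL]

/-- The square of `σ y` lies in `L` but `σ y` does not, so `σ y` has no component along `1`. -/
theorem exists_apply_eq_mul (H : IsHyperellipticExtension k x F y) (σ : K ≃ₐ[k] K) :
    ∃ c : L, c ≠ 0 ∧ σ y = c * y ∧ H.lineAction σ (aeval x F) = c ^ 2 * aeval x F := by
  obtain ⟨A, B, hAB⟩ := H.exists_eq_add (σ y)
  have : CharZero L := charZero_of_injective_algebraMap (algebraMap k L).injective
  have hsq : σ y ^ 2 = algebraMap L K (H.lineAction σ (aeval x F)) := by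
    rw [← map_pow, H.sq_eq]
    rfl
  have hB : B ≠ 0 := by
    rintro rfl
    have h1 : y = H.lineAction σ⁻¹ A := by
      rw [coe_lineAction]
      rw [map_zero, zero_mul, add_zero] at hAB
      change σ y = (A : K) at hAB
      rw [← hAB, ← AlgEquiv.mul_apply, inv_mul_cancel, AlgEquiv.one_apply]
    exact H.notMem_range (H.lineAction σ⁻¹ A) h1.symm
  have hA : A = 0 := by
    have h := H.eq_zero_of_mul_mem (b := 2 * A * B)
      (a := H.lineAction σ (aeval x F) - A ^ 2 - B ^ 2 * aeval x F) (by
        rw [hAB] at hsq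
        simp only [map_sub, map_mul, map_pow, map_ofNat, ← H.sq_eq]
        linear_combination hsq)
    simpa [hB] using h
  rw [hA, map_zero, zero_add] at hAB
  refine ⟨B, hB, hAB, (algebraMap L K).injective ?_⟩
  rw [← hsq, hAB, mul_pow, H.sq_eq, map_mul, map_pow]

theorem card_fixingSubgroup (H : IsHyperellipticExtension k x F y) :
    Nat.card L.fixingSubgroup = 2 := by
  have : Algebra.IsQuadraticExtension L K :=
    { finrank_eq_two' := H.finrank_eq_two }
  have : CharZero L := charZero_of_injective_algebraMap (algebraMap k L).injective
  have : FiniteDimensional L K := Module.finite_of_finrank_pos (by rw [H.finrank_eq_two]; simp)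
  have : IsGalois L K := ⟨⟩
  rw [Nat.card_congr (fixingSubgroupEquiv L).toEquiv, IsGalois.card_aut_eq_finrank,
    H.finrank_eq_two]

theorem mem_fixingSubgroup_iff (H : IsHyperellipticExtension k x F y) {σ : K ≃ₐ[k] K} :
    σ ∈ L.fixingSubgroup ↔ H.lineAction σ = 1 := by
  rw [← H.ker_lineAction, MonoidHom.mem_ker]

end IsHyperellipticExtension

end

/-! ### From the equation of the curve to a quadratic extension -/

section

open Polynomial IntermediateField

namespace IsHyperelliptic

variable {k K : Type*} [Field k] [Field K] [Algebra k K] {g : ℕ} {F : k[X]} {x y : K}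

theorem exists_eq_add (hK : IsHyperelliptic k K g F x y) (w : K) :
    ∃ a b : k⟮x⟯, w = algebraMap k⟮x⟯ K a + algebraMap k⟮x⟯ K b * y := by
  set f : k⟮x⟯ := aeval (AdjoinSimple.gen k x) F with hf
  have hfy : y ^ 2 = algebraMap k⟮x⟯ K f := by
    rw [hf, ← aeval_algebraMap_apply, AdjoinSimple.algebraMap_gen, hK.equation]
  have hmonic : (X ^ 2 - C f : k⟮x⟯[X]).Monic := monic_X_pow_sub_C f two_ne_zero
  have hroot : aeval y (X ^ 2 - C f : k⟮x⟯[X]) = 0 := by simp [hfy]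
  have htop : k⟮x⟯⟮y⟯ = ⊤ := by
    apply restrictScalars_injective k
    rw [adjoin_simple_adjoin_simple, hK.adjoin_eq_top]
    rfl
  have hw : w ∈ k⟮x⟯⟮y⟯.toSubalgebra := by rw [htop]; trivial
  rw [adjoin_simple_toSubalgebra_of_isAlgebraic ⟨_, hmonic.ne_zero, hroot⟩,
    Algebra.adjoin_singleton_eq_range_aeval] at hw
  obtain ⟨P, rfl⟩ := hw
  -- Reducing a polynomial in `y` modulo `Y² - f` leaves a linear remainder.
  have hdeg : (P %ₘ (X ^ 2 - C f)).natDegree ≤ 1 := by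
    have := natDegree_modByMonic_lt P hmonic (fun h => by
      simpa [h] using natDegree_X_pow_sub_C (n := 2) (r := f))
    rw [natDegree_X_pow_sub_C] at this
    omega
  refine ⟨(P %ₘ (X ^ 2 - C f)).coeff 0, (P %ₘ (X ^ 2 - C f)).coeff 1, ?_⟩
  change aeval y P = _
  conv_lhs => rw [← modByMonic_add_div P (X ^ 2 - C f), map_add, map_mul, hroot, zero_mul,
    add_zero, eq_X_add_C_of_natDegree_le_one hdeg]
  simp [add_comm]

theorem isHyperellipticExtension (hK : IsHyperelliptic k K g F x y) :
    IsHyperellipticExtension k (AdjoinSimple.gen k x) F y where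
  isCoordinate :=
    { transcendental := fun h => hK.transcendental (by
        rw [← AdjoinSimple.algebraMap_gen k x]
        exact (isAlgebraic_algebraMap_iff (algebraMap k⟮x⟯ K).injective).2 h)
      adjoin_eq_top := lift_injective _ (by
        rw [lift_adjoin_simple, lift_top, AdjoinSimple.coe_gen]) }
  squarefree := hK.squarefree
  even_natDegree := ⟨g + 1, by rw [hK.natDegree_eq]; ring⟩
  six_le_natDegree := by have := hK.two_le_genus; rw [hK.natDegree_eq]; omega
  sq_eq := by rw [← aeval_algebraMap_apply, AdjoinSimple.algebraMap_gen, hK.equation]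
  exists_eq_add := hK.exists_eq_add

end IsHyperelliptic

end

/-! ### Double covers of groups and their classification -/

/-- A surjective homomorphism with kernel of order two, generated by `z`. -/
structure IsDoubleCover {A Q : Type*} [Group A] [Group Q] (π : A →* Q) (z : A) : Prop where
  surjective : Function.Surjective π
  eq_one_iff : ∀ a, π a = 1 ↔ a = 1 ∨ a = z
  ne_one : z ≠ 1

namespace IsDoubleCover

variable {A B Q : Type*} [Group A] [Group B] [Group Q] {π : A →* Q} {z : A}

theorem map_eq_one (h : IsDoubleCover π z) : π z = 1 := (h.eq_one_iff z).2 (Or.inr rfl)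

theorem mul_self (h : IsDoubleCover π z) : z * z = 1 := by
  have h1 : π (z * z) = 1 := by rw [map_mul, h.map_eq_one, one_mul]
  exact ((h.eq_one_iff _).1 h1).resolve_right fun h2 => h.ne_one (mul_eq_right.1 h2)

theorem comm (h : IsDoubleCover π z) (a : A) : a * z = z * a := by
  have h1 : π (a * z * a⁻¹) = 1 := by simp [h.map_eq_one]
  rcases (h.eq_one_iff _).1 h1 with h2 | h2
  · exact absurd (conj_eq_one_iff.1 h2) h.ne_one
  · rwa [mul_inv_eq_iff_eq_mul] at h2

theorem mul_self_eq_or (h : IsDoubleCover π z) {a : A} (ha : π a * π a = 1) :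
    a * a = 1 ∨ a * a = z :=
  (h.eq_one_iff _).1 (by rw [map_mul, ha])

end IsDoubleCover

/-- Such a group is a vector space over `𝔽₂`, and linear forms separate its points. -/
theorem exists_hom_ne_one_of_mul_self_eq_one {N : Type*} [Group N] (hN : ∀ n : N, n * n = 1)
    {z : N} (hz : z ≠ 1) : ∃ ψ : N →* Multiplicative (ZMod 2), ψ z ≠ 1 := by
  have hcomm : ∀ a b : N, a * b = b * a := fun a b => by
    have h1 : ∀ n : N, n⁻¹ = n := fun n => inv_eq_of_mul_eq_one_left (hN n)
    rw [← h1 (a * b), mul_inv_rev, h1, h1]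
  let _ : CommGroup N := { mul_comm := hcomm }
  let _ : Module (ZMod 2) (Additive N) := AddCommGroup.zmodModule fun n => by
    rw [two_nsmul]
    exact hN n
  have h : ¬ ∀ φ : Module.Dual (ZMod 2) (Additive N), φ (Additive.ofMul z) = 0 := by
    rw [Module.forall_dual_apply_eq_zero_iff]
    exact hz
  push Not at h
  obtain ⟨φ, hφ⟩ := h
  exact ⟨AddMonoidHom.toMultiplicativeRight φ.toAddMonoidHom, hφ⟩

/-- The transfer of a character `ψ` of `N` takes the central element `z` to `ψ(z)` to the power
`N.index`, which is `ψ(z)` because the index is odd and `z² = 1`. -/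
theorem exists_hom_ne_one_of_odd_index {P : Type*} [Group P] (N : Subgroup P)
    (hodd : Odd N.index) (hN : ∀ n ∈ N, n * n = 1) {z : P} (hzN : z ∈ N)
    (hzc : ∀ p, p * z = z * p) (hz : z ≠ 1) : ∃ χ : P →* Multiplicative (ZMod 2), χ z ≠ 1 := by
  have : N.FiniteIndex := ⟨fun h => by simp [h] at hodd⟩
  obtain ⟨ψ, hψ⟩ := exists_hom_ne_one_of_mul_self_eq_one (N := N)
    (fun n => Subtype.ext (hN n n.2)) (z := ⟨z, hzN⟩) (fun h => hz (congr_arg Subtype.val h))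
  refine ⟨MonoidHom.transfer ψ, ?_⟩
  rw [MonoidHom.transfer_eq_pow ψ z fun n p _ => by
    have hc : Commute p z := hzc p
    rw [mul_assoc, ← (hc.pow_right n).eq, inv_mul_cancel_left]]
  obtain ⟨m, hm⟩ := hodd
  have hpow : (⟨z, hzN⟩ : N) ^ N.index = ⟨z, hzN⟩ := by
    rw [hm, pow_succ, pow_mul, sq]
    have : (⟨z, hzN⟩ * ⟨z, hzN⟩ : N) = 1 := Subtype.ext (hN z hzN)
    rw [this, one_pow, one_mul]
  convert hψ using 2
  exact hpow

theorem exists_hom_ne_one_of_odd_index_of_normal {P : Type*} [Group P] (N D : Subgroup P)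
    [D.Normal] (hDN : D ≤ N) (hodd : Odd N.index) (hN : ∀ n ∈ N, n * n ∈ D) {z : P} (hzN : z ∈ N)
    (hzc : ∀ p, p * z = z * p) (hz : z ∉ D) :
    ∃ χ : P →* Multiplicative (ZMod 2), χ z ≠ 1 ∧ ∀ d ∈ D, χ d = 1 := by
  obtain ⟨χ, hχ⟩ := exists_hom_ne_one_of_odd_index (N.map (QuotientGroup.mk' D))
    (by rwa [Subgroup.index_map_eq _ (QuotientGroup.mk'_surjective D)
      (by rwa [QuotientGroup.ker_mk'])])
    (by
      rintro _ ⟨n, hn, rfl⟩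
      rw [← map_mul]
      exact (QuotientGroup.eq_one_iff _).2 (hN n hn))
    (Subgroup.mem_map_of_mem _ hzN)
    (by
      intro q
      obtain ⟨p, rfl⟩ := QuotientGroup.mk'_surjective D q
      rw [← map_mul, hzc, map_mul])
    (fun h => hz ((QuotientGroup.eq_one_iff z).1 h))
  refine ⟨χ.comp (QuotientGroup.mk' D), hχ, fun d hd => ?_⟩
  have : QuotientGroup.mk' D d = 1 := (QuotientGroup.eq_one_iff d).2 hd
  rw [MonoidHom.comp_apply, this, map_one]

/-- Two double covers of `Q` are isomorphic as soon as the lifts of the elements of an elementary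
abelian 2-subgroup of odd index have the same orders in both. -/
theorem IsDoubleCover.nonempty_mulEquiv {A B Q : Type*} [Group A] [Group B] [Group Q]
    {π : A →* Q} {π' : B →* Q} {z : A} {z' : B} (h : IsDoubleCover π z) (h' : IsDoubleCover π' z')
    (V : Subgroup Q) (hV : Odd V.index) (hV2 : ∀ q ∈ V, q * q = 1)
    (hsq : ∀ a b, π a = π' b → π a ∈ V → (a * a = 1 ↔ b * b = 1)) : Nonempty (A ≃* B) := by
  -- In the fibre product over `Q`, a character killing `δ = (z, z')` but not `ε = (z, 1)` has as
  -- kernel the graph of an isomorphism `A ≃* B`.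
  let P : Subgroup (A × B) :=
    MonoidHom.eqLocus (π.comp (MonoidHom.fst A B)) (π'.comp (MonoidHom.snd A B))
  have hP : ∀ {a b}, (a, b) ∈ P ↔ π a = π' b := Iff.rfl
  let f : P →* A := (MonoidHom.fst A B).comp P.subtype
  let f' : P →* B := (MonoidHom.snd A B).comp P.subtype
  have hfsurj : Function.Surjective f := fun a => by
    obtain ⟨b, hb⟩ := h'.surjective (π a)
    exact ⟨⟨(a, b), hb.symm⟩, rfl⟩
  have hfsurj' : Function.Surjective f' := fun b => by
    obtain ⟨a, ha⟩ := h.surjective (π' b)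
    exact ⟨⟨(a, b), ha⟩, rfl⟩
  let δ : P := ⟨(z, z'), by rw [hP, h.map_eq_one, h'.map_eq_one]⟩
  let ε : P := ⟨(z, 1), by rw [hP, h.map_eq_one, map_one]⟩
  have hδc : ∀ p : P, p * δ = δ * p := fun p =>
    Subtype.ext (Prod.ext (h.comm p.1.1) (h'.comm p.1.2))
  have hεc : ∀ p : P, p * ε = ε * p := fun p =>
    Subtype.ext (Prod.ext (h.comm p.1.1) (by simp [ε]))
  have hδδ : δ * δ = 1 := Subtype.ext (Prod.ext h.mul_self h'.mul_self)
  let D : Subgroup P := Subgroup.zpowers δ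
  have hmemD : ∀ p ∈ D, p = 1 ∨ p = δ := by
    rintro p ⟨n, rfl⟩
    obtain ⟨m, rfl | rfl⟩ := n.even_or_odd'
    · left
      simp only [zpow_mul, zpow_ofNat, sq, hδδ, one_zpow]
    · right
      simp only [zpow_add, zpow_mul, zpow_ofNat, sq, hδδ, one_zpow, one_mul, pow_one]
  have hDnormal : D.Normal := ⟨fun p hp q => by
    rcases hmemD p hp with rfl | rfl
    · simp [D.one_mem]
    · rwa [hδc, mul_inv_cancel_right]⟩
  let N : Subgroup P := V.comap (π.comp f)
  have hzV : ∀ p : P, π p.1.1 = 1 → p ∈ N := fun p hp => by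
    change π p.1.1 ∈ V
    rw [hp]
    exact V.one_mem
  obtain ⟨χ, hχε, hχD⟩ := exists_hom_ne_one_of_odd_index_of_normal N D
    (fun p hp => by
      rcases hmemD p hp with rfl | rfl
      · exact N.one_mem
      · exact hzV _ h.map_eq_one)
    (by
      have hs : Function.Surjective (π.comp f) := h.surjective.comp hfsurj
      rwa [Subgroup.index_comap_of_surjective _ hs])
    -- This is where equal orders enter: over `V`, both components square to 1, or to `z` and `z'`
    -- respectively, so the square is `1` or `δ`.
    (by
      rintro ⟨⟨a, b⟩, hab⟩ hn
      have haV : π a ∈ V := hn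
      have hab' : π a = π' b := hab
      have hiff := hsq a b hab' haV
      rcases h.mul_self_eq_or (hV2 _ haV) with ha | ha
      · have : (⟨(a, b), hab⟩ * ⟨(a, b), hab⟩ : P) = 1 :=
          Subtype.ext (Prod.ext ha (hiff.1 ha))
        rw [this]
        exact D.one_mem
      · have hb : b * b = z' := by
          refine (h'.mul_self_eq_or (hV2 _ (hab' ▸ haV))).resolve_left fun hb => ?_
          rw [hiff.2 hb] at ha
          exact h.ne_one ha.symm
        have : (⟨(a, b), hab⟩ * ⟨(a, b), hab⟩ : P) = δ := Subtype.ext (Prod.ext ha hb)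
        rw [this]
        exact Subgroup.mem_zpowers δ)
    (z := ε) (hzV _ h.map_eq_one) hεc (fun hε => by
      rcases hmemD _ hε with h1 | h1
      · exact h.ne_one (congr_arg (fun p : P => p.1.1) h1)
      · exact h'.ne_one (congr_arg (fun p : P => p.1.2) h1).symm)
  have hχδ : χ δ = 1 := hχD δ (Subgroup.mem_zpowers δ)
  have htwo : ∀ a b : Multiplicative (ZMod 2), a ≠ 1 → b ≠ 1 → a * b = 1 := by decide
  let R : Subgroup P := χ.ker
  have hbij : Function.Bijective (f.comp R.subtype) := by
    constructor
    · rw [injective_iff_map_eq_one]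
      rintro ⟨⟨⟨a, b⟩, hab⟩, hR⟩ (ha : a = 1)
      subst ha
      have hb : π' b = 1 := by rw [← hP.1 hab, map_one]
      rcases (h'.eq_one_iff b).1 hb with rfl | rfl
      · rfl
      · exfalso
        apply hχε
        have : (ε : P) = δ * ⟨(1, b), hab⟩ :=
          Subtype.ext (Prod.ext (mul_one z).symm h'.mul_self.symm)
        rw [this, map_mul, hχδ, one_mul]
        exact hR
    · intro a
      obtain ⟨p, rfl⟩ := hfsurj a
      by_cases hp : χ p = 1
      · exact ⟨⟨p, hp⟩, rfl⟩
      -- Multiplying by `ε δ = (1, z')` changes the sign of `χ` but not the first component.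
      · refine ⟨⟨p * (ε * δ), ?_⟩, ?_⟩
        · change χ (p * (ε * δ)) = 1
          rw [map_mul, map_mul, hχδ, mul_one]
          exact htwo _ _ hp hχε
        · change p.1.1 * (z * z) = p.1.1
          rw [h.mul_self, mul_one]
  have hbij' : Function.Bijective (f'.comp R.subtype) := by
    constructor
    · rw [injective_iff_map_eq_one]
      rintro ⟨⟨⟨a, b⟩, hab⟩, hR⟩ (hb : b = 1)
      subst hb
      have ha : π a = 1 := by rw [hP.1 hab, map_one]
      rcases (h.eq_one_iff a).1 ha with rfl | rfl
      · rfl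
      · exact absurd hR hχε
    · intro b
      obtain ⟨p, rfl⟩ := hfsurj' b
      by_cases hp : χ p = 1
      · exact ⟨⟨p, hp⟩, rfl⟩
      · refine ⟨⟨p * ε, ?_⟩, ?_⟩
        · change χ (p * ε) = 1
          rw [map_mul]
          exact htwo _ _ hp hχε
        · exact mul_one _
  exact ⟨(MulEquiv.ofBijective _ hbij).symm.trans (MulEquiv.ofBijective _ hbij')⟩

/-! ### `SL₂(𝔽₃)` as a double cover of `A₄` -/

section

open Matrix

/-- The line in the plane over the field with three elements through the given vector. -/
def lineIndex (v : Fin 2 → ZMod 3) : Fin 4 :=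
  if v 1 = 0 then 0 else if v 0 = 0 then 1 else if v 0 = v 1 then 2 else 3

/-- A vector on the given line. -/
def lineVector (i : Fin 4) : Fin 2 → ZMod 3 := ![![1, 0], ![0, 1], ![1, 1], ![2, 1]] i

/-- The image of a line does not depend on the vector representing it; this gives the composition
law of the action below. -/
theorem lineIndex_mulVec (M : Matrix (Fin 2) (Fin 2) (ZMod 3)) (v : Fin 2 → ZMod 3) (hv : v ≠ 0)
    (hM : M.det = 1) : lineIndex (M *ᵥ lineVector (lineIndex v)) = lineIndex (M *ᵥ v) := by
  have key : ∀ a b c d p q : ZMod 3, a * d - b * c = 1 → ¬ (p = 0 ∧ q = 0) →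
      lineIndex ![a * lineVector (lineIndex ![p, q]) 0 + b * lineVector (lineIndex ![p, q]) 1,
        c * lineVector (lineIndex ![p, q]) 0 + d * lineVector (lineIndex ![p, q]) 1] =
      lineIndex ![a * p + b * q, c * p + d * q] := by
    decide
  rw [det_fin_two] at hM
  have h := key _ _ _ _ (v 0) (v 1) hM (fun h => hv (by ext i; fin_cases i; exacts [h.1, h.2]))
  have hv' : ![v 0, v 1] = v := by ext i; fin_cases i <;> rfl
  rw [hv'] at h
  rw [mulVec_fin_two, mulVec_fin_two]
  exact h

open scoped MatrixGroups

theorem lineVector_ne_zero : ∀ i, lineVector i ≠ 0 := by decide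

theorem lineIndex_lineVector : ∀ i, lineIndex (lineVector i) = i := by decide

theorem mulVec_lineVector_ne_zero (M : SL(2, ZMod 3)) (i : Fin 4) :
    M.1 *ᵥ lineVector i ≠ 0 := by
  intro h
  apply lineVector_ne_zero i
  have hM : M⁻¹.1 * M.1 = 1 := congr_arg Subtype.val (inv_mul_cancel M)
  rw [← one_mulVec (lineVector i), ← hM, ← mulVec_mulVec, h, mulVec_zero]

/-- The permutation of the four lines of the plane over the field with three elements. -/
instance : MulAction SL(2, ZMod 3) (Fin 4) where
  smul M i := lineIndex (M.1 *ᵥ lineVector i)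
  one_smul i := by
    change lineIndex ((1 : Matrix (Fin 2) (Fin 2) (ZMod 3)) *ᵥ lineVector i) = i
    rw [one_mulVec, lineIndex_lineVector]
  mul_smul M N i := by
    change lineIndex ((M.1 * N.1) *ᵥ lineVector i) =
      lineIndex (M.1 *ᵥ lineVector (lineIndex (N.1 *ᵥ lineVector i)))
    rw [lineIndex_mulVec _ _ (mulVec_lineVector_ne_zero N i) M.2, mulVec_mulVec]

theorem card_sl : Nat.card SL(2, ZMod 3) = 24 := by
  rw [Nat.card_eq_fintype_card]
  decide

theorem sl_mul_self_eq_one_iff : ∀ M : SL(2, ZMod 3), M * M = 1 ↔ M = 1 ∨ M = -1 := by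
  decide

theorem sign_toPerm : ∀ M : SL(2, ZMod 3), Equiv.Perm.sign (MulAction.toPermHom SL(2, ZMod 3) (Fin 4) M) = 1 := by
  decide

theorem toPerm_eq_one_iff : ∀ M : SL(2, ZMod 3), MulAction.toPermHom SL(2, ZMod 3) (Fin 4) M = 1 ↔
    M = 1 ∨ M = -1 := by
  decide

/-- The action of `SL₂(𝔽₃)` on the four lines of the plane, with values in `A₄`. -/
def slToAlternating : SL(2, ZMod 3) →* alternatingGroup (Fin 4) :=
  (MulAction.toPermHom SL(2, ZMod 3) (Fin 4)).codRestrict _ fun M =>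
    Equiv.Perm.mem_alternatingGroup.2 (sign_toPerm M)

theorem slToAlternating_eq_one_iff (M : SL(2, ZMod 3)) :
    slToAlternating M = 1 ↔ M = 1 ∨ M = -1 := by
  rw [← toPerm_eq_one_iff, Subtype.ext_iff]
  rfl

theorem card_alternatingGroup_fin_four : Nat.card (alternatingGroup (Fin 4)) = 12 := by
  rw [nat_card_alternatingGroup, Nat.card_fin]
  decide

theorem isDoubleCover_slToAlternating : IsDoubleCover slToAlternating (-1) where
  surjective := by
    have hne : (1 : SL(2, ZMod 3)) ≠ -1 := by decide
    have hker : (slToAlternating.ker : Set SL(2, ZMod 3)) = {1, -1} := by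
      ext M
      exact slToAlternating_eq_one_iff M
    have hcard : Nat.card slToAlternating.ker = 2 := by
      rw [← SetLike.coe_sort_coe, hker, Nat.card_coe_set_eq, Set.ncard_pair hne]
    have h := slToAlternating.ker.card_mul_index
    -- The kernel `{1, -1}` has order 2, so the image has order `24 / 2 = 12`, which is the order of
    -- `A₄`.
    rw [hcard, Subgroup.index_ker, card_sl] at h
    rw [← MonoidHom.range_eq_top]
    apply Subgroup.eq_top_of_card_eq
    rw [card_alternatingGroup_fin_four]
    omega
  eq_one_iff := slToAlternating_eq_one_iff
  ne_one := by decide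

theorem isDoubleCover_snd (Q : Type*) [Group Q] :
    IsDoubleCover (MonoidHom.snd (Multiplicative (ZMod 2)) Q) (Multiplicative.ofAdd 1, 1) where
  surjective q := ⟨(1, q), rfl⟩
  eq_one_iff := by
    rintro ⟨a, q⟩
    have : ∀ a : Multiplicative (ZMod 2), a = 1 ∨ a = Multiplicative.ofAdd 1 := by decide
    rcases this a with rfl | rfl <;> simp [Prod.ext_iff]
  ne_one h := by
    have : (Multiplicative.ofAdd 1 : Multiplicative (ZMod 2)) ≠ 1 := by decide
    exact this (congr_arg Prod.fst h)

theorem exists_odd_index_alternatingGroup :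
    ∃ V : Subgroup (alternatingGroup (Fin 4)),
      Odd V.index ∧ Nat.card V = 4 ∧ ∀ q ∈ V, q * q = 1 := by
  have h4 : Nat.card (Fin 4) = 4 := Nat.card_fin 4
  refine ⟨alternatingGroup.kleinFour (Fin 4), ?_,
    alternatingGroup.kleinFour_card_of_card_eq_four h4, fun q hq => ?_⟩
  · have h := (alternatingGroup.kleinFour (Fin 4)).card_mul_index
    rw [alternatingGroup.kleinFour_card_of_card_eq_four h4, card_alternatingGroup_fin_four] at h
    exact ⟨1, by omega⟩
  · have h := Monoid.pow_exponent_eq_one (⟨q, hq⟩ : alternatingGroup.kleinFour (Fin 4))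
    rw [alternatingGroup.exponent_kleinFour_of_card_eq_four h4, sq] at h
    exact congr_arg Subtype.val h

namespace IsDoubleCover

variable {A : Type*} [Group A] {π : A →* alternatingGroup (Fin 4)} {z : A}

theorem nonempty_mulEquiv_prod (h : IsDoubleCover π z)
    (hsq : ∀ a, π a * π a = 1 → a * a = 1) :
    Nonempty (A ≃* Multiplicative (ZMod 2) × alternatingGroup (Fin 4)) := by
  obtain ⟨V, hV, -, hV2⟩ := exists_odd_index_alternatingGroup
  refine h.nonempty_mulEquiv (isDoubleCover_snd _) V hV hV2 ?_
  rintro a ⟨c, q⟩ (rfl : π a = q) ha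
  have hc : ∀ c : Multiplicative (ZMod 2), c * c = 1 := by decide
  have h1 := hV2 _ ha
  exact iff_of_true (hsq a h1) (Prod.ext (hc c) h1)

/-- In `SL₂(𝔽₃)` the only involution is `-1`, so there too no lift of a nontrivial involution
squares to 1. -/
theorem nonempty_mulEquiv_sl (h : IsDoubleCover π z)
    (hsq : ∀ a, π a * π a = 1 → π a ≠ 1 → a * a ≠ 1) :
    Nonempty (A ≃* SL(2, ZMod 3)) := by
  obtain ⟨V, hV, -, hV2⟩ := exists_odd_index_alternatingGroup
  refine h.nonempty_mulEquiv isDoubleCover_slToAlternating V hV hV2 fun a M haM ha => ?_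
  rw [sl_mul_self_eq_one_iff, ← slToAlternating_eq_one_iff, ← haM]
  refine ⟨fun h1 => by_contra fun h2 => hsq a (hV2 _ ha) h2 h1, fun h1 => ?_⟩
  rcases (h.eq_one_iff a).1 h1 with rfl | rfl
  · exact one_mul 1
  · exact h.mul_self

end IsDoubleCover

end

/-! ### Counting places under `A₄` -/

section

open Polynomial IntermediateField

theorem MulAction.card_dvd_ncard_of_free {G X : Type*} [Group G] [MulAction G X]
    {S : Set X} (hinv : ∀ (g : G), ∀ p ∈ S, g • p ∈ S)
    (hfree : ∀ (g : G), ∀ p ∈ S, g • p = p → g = 1) : Nat.card G ∣ S.ncard := by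
  let T : SubMulAction G X := ⟨S, fun g {p} hp => hinv g p hp⟩
  have hT : ∀ p : T, MulAction.stabilizer G p = ⊥ := fun p => by
    rw [eq_bot_iff]
    intro g hg
    exact hfree g p p.2 (congr_arg Subtype.val hg)
  have h := Nat.card_congr (MulAction.selfEquivOrbitsQuotientProd hT)
  rw [Nat.card_prod] at h
  rw [← Nat.card_coe_set_eq]
  exact ⟨_, h.trans (mul_comm _ _)⟩

/-- Conjugacy transfers the order of the lifts from one involution to the others. -/
theorem isConj_of_involutions_alternatingGroup : ∀ q q' : alternatingGroup (Fin 4), q ≠ 1 →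
    q * q = 1 → q' ≠ 1 → q' * q' = 1 → ∃ h, h * q = q' * h := by
  decide

section Line

variable {k L : Type*} [Field k] [Field L] [Algebra k L]
  {G : Subgroup (L ≃ₐ[k] L)}

theorem ncard_involutions (γ : G ≃* alternatingGroup (Fin 4)) :
    {s : L ≃ₐ[k] L | s ∈ G ∧ s ≠ 1 ∧ s * s = 1}.ncard = 3 := by
  have h : {s : L ≃ₐ[k] L | s ∈ G ∧ s ≠ 1 ∧ s * s = 1} =
      (fun q => (γ.symm q).1) '' {q | q ≠ 1 ∧ q * q = 1} := by
    ext s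
    constructor
    · rintro ⟨hs, hs1, hss⟩
      refine ⟨γ ⟨s, hs⟩, ⟨?_, ?_⟩, by simp⟩
      · rw [Ne, EmbeddingLike.map_eq_one_iff]
        exact fun h => hs1 (congr_arg Subtype.val h)
      · rw [← map_mul, EmbeddingLike.map_eq_one_iff]
        exact Subtype.ext hss
    · rintro ⟨q, ⟨hq1, hqq⟩, rfl⟩
      refine ⟨(γ.symm q).2, ?_, ?_⟩
      · simpa using hq1
      · have := congr_arg (fun q => (γ.symm q).1) hqq
        simpa using this
  have hinj : Function.Injective fun q => (γ.symm q).1 :=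
    Subtype.val_injective.comp γ.symm.injective
  rw [h, Set.ncard_image_of_injective _ hinj]
  have h3 : (Finset.univ.filter fun q : alternatingGroup (Fin 4) => q ≠ 1 ∧ q * q = 1).card = 3 := by
    decide
  rw [← h3, ← Set.ncard_coe_finset]
  simp

/-- The places fixed by some involution of `G`. -/
def involutionFixedPlaces (G : Subgroup (L ≃ₐ[k] L)) : Set (Place k L) :=
  {p | ∃ s ∈ G, s ≠ 1 ∧ s * s = 1 ∧ s • p = p}

/-- Three involutions with two fixed places each, and no place fixed by two of them. -/
theorem ncard_involutionFixedPlaces [IsAlgClosed k] [CharZero k] {x : L} (hx : IsCoordinate k x)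
    (γ : G ≃* alternatingGroup (Fin 4)) : (involutionFixedPlaces G).ncard = 6 := by
  classical
  have : Finite G := Finite.of_equiv _ γ.symm.toEquiv
  have hfin : {s : L ≃ₐ[k] L | s ∈ G ∧ s ≠ 1 ∧ s * s = 1}.Finite :=
    Set.finite_of_ncard_ne_zero (by rw [ncard_involutions γ]; simp)
  have hfix : ∀ s ∈ {s : L ≃ₐ[k] L | s ∈ G ∧ s ≠ 1 ∧ s * s = 1},
      {p : Place k L | s • p = p}.Finite := fun s hs =>
    Set.finite_of_ncard_ne_zero (by
      rw [Place.ncard_fixed_involution hx hs.2.2 hs.2.1]; simp)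
  have hset : involutionFixedPlaces G =
      ⋃ s ∈ {s : L ≃ₐ[k] L | s ∈ G ∧ s ≠ 1 ∧ s * s = 1}, {p : Place k L | s • p = p} := by
    ext p
    simp [involutionFixedPlaces, and_assoc]
  have hdisj : {s : L ≃ₐ[k] L | s ∈ G ∧ s ≠ 1 ∧ s * s = 1}.PairwiseDisjoint
      fun s => {p : Place k L | s • p = p} := by
    intro s hs s' hs' hne
    rw [Function.onFun, Set.disjoint_left]
    intro p hp hp'
    refine hne (Place.eq_of_involutions_fix hx hs.2.2 hs.2.1 hp hs'.2.2 hs'.2.1 hp' ?_)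
    exact G.subtype.isOfFinOrder (isOfFinOrder_of_finite (⟨_, mul_mem hs.1 hs'.1⟩ : G))
  rw [hset, hfin.ncard_biUnion hfix hdisj, finsum_mem_congr rfl fun s hs =>
    Place.ncard_fixed_involution hx hs.2.2 hs.2.1, finsum_mem_eq_finite_toFinset_sum _ hfin,
    Finset.sum_const, ← Set.ncard_eq_toFinset_card _ hfin, ncard_involutions γ, smul_eq_mul]

/-- The places with nontrivial stabilizer in `G`. -/
def placesWithStabilizer (G : Subgroup (L ≃ₐ[k] L)) : Set (Place k L) :=
  {p | ∃ s ∈ G, s ≠ 1 ∧ s • p = p}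

theorem smul_mem_placesWithStabilizer_iff {g : L ≃ₐ[k] L} (hg : g ∈ G) {p : Place k L} :
    g • p ∈ placesWithStabilizer G ↔ p ∈ placesWithStabilizer G := by
  have key : ∀ (g : L ≃ₐ[k] L), g ∈ G → ∀ p ∈ placesWithStabilizer G,
      g • p ∈ placesWithStabilizer G := by
    rintro g hg p ⟨s, hs, hs1, hsp⟩
    refine ⟨g * s * g⁻¹, mul_mem (mul_mem hg hs) (inv_mem hg), by rwa [Ne, conj_eq_one_iff], ?_⟩
    rw [mul_smul, inv_smul_smul, mul_smul, hsp]
  exact ⟨fun h => by simpa using key _ (inv_mem hg) _ h, key g hg p⟩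

theorem smul_mem_involutionFixedPlaces_iff {g : L ≃ₐ[k] L} (hg : g ∈ G) {p : Place k L} :
    g • p ∈ involutionFixedPlaces G ↔ p ∈ involutionFixedPlaces G := by
  have key : ∀ (g : L ≃ₐ[k] L), g ∈ G → ∀ p ∈ involutionFixedPlaces G,
      g • p ∈ involutionFixedPlaces G := by
    rintro g hg p ⟨s, hs, hs1, hss, hsp⟩
    refine ⟨g * s * g⁻¹, mul_mem (mul_mem hg hs) (inv_mem hg), by rwa [Ne, conj_eq_one_iff], ?_, ?_⟩
    · rw [conj_mul, hss, mul_one, mul_inv_cancel]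
    · rw [mul_smul, inv_smul_smul, mul_smul, hsp]
  exact ⟨fun h => by simpa using key _ (inv_mem hg) _ h, key g hg p⟩

theorem card_dvd_ncard_sdiff {W : Set (Place k L)}
    (hW : ∀ g ∈ G, ∀ p ∈ W, g • p ∈ W) :
    Nat.card G ∣ (W \ placesWithStabilizer G).ncard := by
  refine MulAction.card_dvd_ncard_of_free (G := G) ?_ ?_
  · rintro ⟨g, hg⟩ p ⟨hpW, hpV⟩
    exact ⟨hW g hg p hpW, fun h => hpV ((smul_mem_placesWithStabilizer_iff hg).1 h)⟩
  · rintro ⟨g, hg⟩ p ⟨-, hpV⟩ hgp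
    by_contra hg1
    exact hpV ⟨g, hg, fun h => hg1 (Subtype.ext h), hgp⟩

/-- Elements of order three may fix these places, but the Klein four-group consists of the identity
and involutions, so it acts freely on them. -/
theorem four_dvd_ncard_sdiff (γ : G ≃* alternatingGroup (Fin 4)) {W : Set (Place k L)}
    (hW : ∀ g ∈ G, ∀ p ∈ W, g • p ∈ W) :
    4 ∣ ((placesWithStabilizer G ∩ W) \ involutionFixedPlaces G).ncard := by
  obtain ⟨V, -, hV4, hV2⟩ := exists_odd_index_alternatingGroup
  let φ : alternatingGroup (Fin 4) →* (L ≃ₐ[k] L) := G.subtype.comp γ.symm.toMonoidHom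
  have hφ : Function.Injective φ := Subtype.val_injective.comp γ.symm.injective
  have hcard : Nat.card (V.map φ) = 4 := by rw [Subgroup.card_map_of_injective hφ, hV4]
  have hle : ∀ g ∈ V.map φ, g ∈ G := by
    rintro _ ⟨q, -, rfl⟩
    exact (γ.symm q).2
  rw [← hcard]
  refine MulAction.card_dvd_ncard_of_free (G := V.map φ) ?_ ?_
  · rintro ⟨g, hg⟩ p ⟨⟨hpV, hpW⟩, hp2⟩
    have hgG := hle g hg
    exact ⟨⟨(smul_mem_placesWithStabilizer_iff hgG).2 hpV, hW g hgG p hpW⟩,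
      fun h => hp2 ((smul_mem_involutionFixedPlaces_iff hgG).1 h)⟩
  · rintro ⟨g, hg⟩ p ⟨-, hp2⟩ hgp
    by_contra hg1
    refine hp2 ⟨g, hle g hg, fun h => hg1 (Subtype.ext h), ?_, hgp⟩
    obtain ⟨q, hq, rfl⟩ := hg
    rw [← map_mul, hV2 q hq, map_one]

end Line

end

/-! ### Lifts of involutions and the structure of the automorphism group -/

section

open Polynomial IntermediateField

namespace IsHyperellipticExtension

variable {k K : Type*} [Field k] [Field K] [Algebra k K] {L : IntermediateField k K}
  {x : L} {F : k[X]} {y : K} [CharZero k]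

theorem branchPlaces_eq (H : IsHyperellipticExtension k x F y) :
    branchPlaces k L K = {p | p.IsOdd (aeval x F)} := by
  ext p
  exact Place.mem_branchPlaces_sqrt_iff H.aeval_ne_zero H.sq_eq H.exists_eq_add p

variable [IsAlgClosed k]

/-- Automorphisms coming from the curve change `F(x)` only by a square factor, which leaves the
parity of orders intact. -/
theorem smul_mem_branchPlaces (H : IsHyperellipticExtension k x F y) {g : L ≃ₐ[k] L}
    (hg : g ∈ H.lineAction.range) {p : Place k L} (hp : p ∈ branchPlaces k L K) :
    g • p ∈ branchPlaces k L K := by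
  obtain ⟨σ, rfl⟩ := hg
  rw [H.branchPlaces_eq] at hp ⊢
  obtain ⟨c, hc, -, hF⟩ := H.exists_apply_eq_mul σ
  change Place.IsOdd _ _
  rw [← Place.isOdd_sq_mul_iff hc, ← hF, Place.isOdd_smul_map_iff]
  exact hp

/-- A lift of an involution of the line has order two or four according to whether the fixed
places of the involution are unramified or ramified. -/
theorem mul_self_eq_one_iff (H : IsHyperellipticExtension k x F y) {σ : K ≃ₐ[k] K}
    (hσ : H.lineAction σ * H.lineAction σ = 1) (hσ1 : H.lineAction σ ≠ 1) {p : Place k L}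
    (hp : H.lineAction σ • p = p) : σ * σ = 1 ↔ p ∉ branchPlaces k L K := by
  obtain ⟨c, hc, hcy, hF⟩ := H.exists_apply_eq_mul σ
  obtain ⟨hodd, heven⟩ := Place.map_mul_self_of_involution H.isCoordinate hσ hσ1 hp
    H.aeval_ne_zero hF
  -- `σ²` acts trivially on `L` and multiplies `y` by the sign `s c * c`, where `s` is the image of
  -- `σ`.
  have hy : (σ * σ) y = ((H.lineAction σ c * c : L) : K) * y := by
    rw [AlgEquiv.mul_apply, hcy, map_mul, hcy, ← mul_assoc]
    rfl
  have hy0 : y ≠ 0 := fun h => H.notMem_range 0 (by rw [map_zero, h])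
  have : CharZero K := charZero_of_injective_algebraMap (algebraMap k K).injective
  rw [H.branchPlaces_eq]
  change _ ↔ ¬ p.IsOdd _
  constructor
  · intro h hp'
    rw [hodd hp', h, AlgEquiv.one_apply] at hy
    simp [self_eq_neg, hy0] at hy
  · intro hp'
    refine H.ext_of_apply (by rw [map_mul, hσ, map_one]) ?_
    rw [hy, heven hp']
    simp

theorem exists_isDoubleCover (H : IsHyperellipticExtension k x F y) {Q : Type*} [Group Q]
    (γ : H.lineAction.range ≃* Q) :
    ∃ z, IsDoubleCover (γ.toMonoidHom.comp H.lineAction.rangeRestrict) z := by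
  obtain ⟨z, hz, hz1⟩ : ∃ z ∈ L.fixingSubgroup, z ≠ 1 := by
    by_contra! h
    have := H.card_fixingSubgroup
    rw [(Subgroup.eq_bot_iff_forall _).2 h, Subgroup.card_bot] at this
    omega
  have hset : (L.fixingSubgroup : Set (K ≃ₐ[k] K)) = {1, z} := by
    refine (Set.eq_of_subset_of_ncard_le ?_ ?_ ?_).symm
    · rintro _ (rfl | rfl)
      · exact L.fixingSubgroup.one_mem
      · exact hz
    · rw [Set.ncard_pair hz1.symm, ← Nat.card_coe_set_eq]
      exact H.card_fixingSubgroup.le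
    · refine Set.finite_of_ncard_ne_zero ?_
      rw [← Nat.card_coe_set_eq]
      exact (H.card_fixingSubgroup.trans_ne two_ne_zero)
  refine ⟨z, γ.surjective.comp H.lineAction.rangeRestrict_surjective, fun a => ?_, hz1⟩
  have h1 : γ.toMonoidHom.comp H.lineAction.rangeRestrict a = 1 ↔ H.lineAction a = 1 := by
    rw [MonoidHom.comp_apply, MulEquiv.coe_toMonoidHom, EmbeddingLike.map_eq_one_iff,
      Subtype.ext_iff]
    rfl
  rw [h1, ← H.mem_fixingSubgroup_iff, ← SetLike.mem_coe, hset]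
  rfl

/-- The structure of the automorphism group, and the number of ramified places with nontrivial
stabilizer modulo `4` and `12`, when the reduced automorphism group is `A₄`. -/
theorem of_range_mulEquiv (H : IsHyperellipticExtension k x F y)
    (γ : H.lineAction.range ≃* alternatingGroup (Fin 4)) :
    ∃ n : ℕ, (placesWithStabilizer H.lineAction.range ∩ branchPlaces k L K).encard = n ∧
      n ≤ F.natDegree ∧ 12 ∣ F.natDegree - n ∧
      (4 ∣ n ∧ Nonempty ((K ≃ₐ[k] K) ≃* Multiplicative (ZMod 2) × alternatingGroup (Fin 4)) ∨
        n % 4 = 2 ∧ Nonempty ((K ≃ₐ[k] K) ≃* Matrix.SpecialLinearGroup (Fin 2) (ZMod 3))) := by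
  set G := H.lineAction.range with hG
  set W := branchPlaces k L K with hW
  have hWcard : W.encard = F.natDegree := by
    rw [hW, H.branchPlaces_eq]
    exact Place.encard_isOdd_aeval H.isCoordinate H.squarefree H.even_natDegree
  have hWfin : W.Finite := Set.finite_of_encard_eq_coe hWcard
  have hWn : W.ncard = F.natDegree := by rw [Set.ncard_def, hWcard, ENat.toNat_natCast]
  have hWG : ∀ g ∈ G, ∀ p ∈ W, g • p ∈ W := fun g hg p hp => H.smul_mem_branchPlaces hg hp
  have hfin : (placesWithStabilizer G ∩ W).Finite := hWfin.subset Set.inter_subset_right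
  refine ⟨(placesWithStabilizer G ∩ W).ncard, hfin.cast_ncard_eq.symm, ?_, ?_, ?_⟩
  · rw [← hWn]
    exact Set.ncard_le_ncard Set.inter_subset_right hWfin
  · have h := card_dvd_ncard_sdiff hWG
    have hGc : Nat.card G = 12 := by
      rw [Nat.card_congr γ.toEquiv, card_alternatingGroup_fin_four]
    have hadd := Set.ncard_inter_add_ncard_sdiff_eq_ncard W (placesWithStabilizer G) hWfin
    rw [Set.inter_comm, hWn] at hadd
    rw [hGc] at h
    rwa [← hadd, Nat.add_sub_cancel_left]
  have hsub : involutionFixedPlaces G ⊆ placesWithStabilizer G := by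
    rintro p ⟨s, hs, hs1, -, hsp⟩
    exact ⟨s, hs, hs1, hsp⟩
  have hfour := four_dvd_ncard_sdiff γ hWG
  have hadd := Set.ncard_inter_add_ncard_sdiff_eq_ncard (placesWithStabilizer G ∩ W)
    (involutionFixedPlaces G) hfin
  obtain ⟨z, hz⟩ := H.exists_isDoubleCover γ
  set π := γ.toMonoidHom.comp H.lineAction.rangeRestrict with hπ
  have hπ1 : ∀ a, π a = 1 ↔ H.lineAction a = 1 := fun a => by
    rw [hπ, MonoidHom.comp_apply, MulEquiv.coe_toMonoidHom, EmbeddingLike.map_eq_one_iff,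
      Subtype.ext_iff]
    rfl
  -- Either all lifts of involutions square to 1 and no place fixed by an involution is ramified, or
  -- none do and all six such places are ramified.
  by_cases hlift : ∀ a, π a * π a = 1 → a * a = 1
  · left
    refine ⟨?_, hz.nonempty_mulEquiv_prod hlift⟩
    have hempty : placesWithStabilizer G ∩ W ∩ involutionFixedPlaces G = ∅ := by
      rw [Set.eq_empty_iff_forall_notMem]
      rintro p ⟨⟨-, hpW⟩, _, ⟨σ, rfl⟩, hs1, hss, hsp⟩
      refine (H.mul_self_eq_one_iff hss hs1 hsp).1 (hlift σ ?_) hpW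
      rw [← map_mul, hπ1, map_mul, hss]
    rw [hempty, Set.ncard_empty, zero_add] at hadd
    rwa [← hadd]
  · right
    push Not at hlift
    obtain ⟨a, ha, haa⟩ := hlift
    have hnot : ∀ b, π b * π b = 1 → π b ≠ 1 → b * b ≠ 1 := by
      intro b hb hb1 hbb
      have ha1 : π a ≠ 1 := by
        intro ha1
        rcases (hz.eq_one_iff a).1 ha1 with rfl | rfl
        · exact haa (one_mul 1)
        · exact haa hz.mul_self
      obtain ⟨h, hh⟩ := isConj_of_involutions_alternatingGroup _ _ hb1 hb ha1 ha
      obtain ⟨c, rfl⟩ := hz.surjective h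
      -- A conjugate of `b` lies over the same element as `a`, so it differs from `a` at most by the
      -- central element `z`; as `z² = 1`, the squares agree.
      have h1 : π ((c * b * c⁻¹)⁻¹ * a) = 1 := by
        rw [map_mul, map_inv, inv_mul_eq_one, map_mul, map_mul, hh, map_inv,
          mul_inv_cancel_right]
      have h2 : c * b * c⁻¹ * (c * b * c⁻¹) = 1 := by
        rw [conj_mul, hbb, mul_one, mul_inv_cancel]
      apply haa
      rcases (hz.eq_one_iff _).1 h1 with h3 | h3
      · rw [← inv_mul_eq_one.1 h3, h2]
      · rw [inv_mul_eq_iff_eq_mul] at h3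
        rw [h3, mul_assoc, ← mul_assoc z, ← hz.comm, mul_assoc _ z z, hz.mul_self, mul_one, h2]
    refine ⟨?_, hz.nonempty_mulEquiv_sl hnot⟩
    have hfull : placesWithStabilizer G ∩ W ∩ involutionFixedPlaces G =
        involutionFixedPlaces G := by
      refine Set.inter_eq_right.2 fun p hp => ⟨hsub hp, ?_⟩
      obtain ⟨_, ⟨σ, rfl⟩, hs1, hss, hsp⟩ := hp
      by_contra hpW
      refine hnot σ ?_ ?_ ((H.mul_self_eq_one_iff hss hs1 hsp).2 hpW)
      · rw [← map_mul, hπ1, map_mul, hss]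
      · rwa [Ne, hπ1]
    rw [hfull, ncard_involutionFixedPlaces H.isCoordinate γ] at hadd
    omega

end IsHyperellipticExtension

end

/-! ### The theorem -/

theorem lemma4p1 (k K : Type*) [Field k] [IsAlgClosed k] [CharZero k] [Field K] [Algebra k K]
    (g : ℕ) (F : Polynomial k) (x y : K) (hK : IsHyperelliptic k K g F x y)
    (hred : Nonempty (Hyperelliptic.ReducedAut k x ≃* alternatingGroup (Fin 4)))
    (hg2 : g ≠ 2) (hg3 : g ≠ 3) (hg6 : g ≠ 6) :
    let n : ℕ∞ := (Hyperelliptic.branchFibers k x ∩ Hyperelliptic.weierstrassImages k x).encard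
    ((n = 0 ∨ n = 4 ∨ n = 8) →
      Nonempty ((K ≃ₐ[k] K) ≃* Multiplicative (ZMod 2) × alternatingGroup (Fin 4))) ∧
    (n = 0 → (g : ℤ) ≡ -1 [ZMOD 6]) ∧
    (n = 4 → (g : ℤ) ≡ 1 [ZMOD 6]) ∧
    (n = 8 → (g : ℤ) ≡ 3 [ZMOD 6]) ∧
    ((n = 6 ∨ n = 10 ∨ n = 14) →
      Nonempty ((K ≃ₐ[k] K) ≃* Matrix.SpecialLinearGroup (Fin 2) (ZMod 3))) ∧
    (n = 6 → (g : ℤ) ≡ 2 [ZMOD 6]) ∧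
    (n = 10 → (g : ℤ) ≡ 4 [ZMOD 6]) ∧
    (n = 14 → (g : ℤ) ≡ 0 [ZMOD 6]) := by
  have H := hK.isHyperellipticExtension
  obtain ⟨e⟩ := hred
  -- The kernel of a homomorphism is normal, so the normal closure in the definition of the reduced
  -- group adds nothing.
  have hker : H.lineAction.ker =
      Subgroup.normalClosure (Hyperelliptic.involutionSubgroup k x : Set (K ≃ₐ[k] K)) := by
    have h : H.lineAction.ker = Hyperelliptic.involutionSubgroup k x := H.ker_lineAction
    have hn : (Hyperelliptic.involutionSubgroup k x).Normal := h ▸ H.lineAction.normal_ker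
    rw [h, Subgroup.normalClosure_eq_self]
  let γ : H.lineAction.range ≃* alternatingGroup (Fin 4) :=
    (QuotientGroup.quotientKerEquivRange H.lineAction).symm.trans
      ((QuotientGroup.quotientMulEquivOfEq hker).trans e)
  have hGfin : Finite H.lineAction.range := Finite.of_equiv _ γ.symm.toEquiv
  have hE : ∀ f, f ∈ Hyperelliptic.quotientField k x ↔ ∀ g ∈ H.lineAction.range, g f = f := by
    intro f
    constructor
    · rintro hf _ ⟨σ, rfl⟩
      exact Subtype.ext (hf ⟨σ, trivial⟩)
    · rintro hf ⟨σ, -⟩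
      exact congr_arg Subtype.val (hf _ ⟨σ, rfl⟩)
  have hV : Hyperelliptic.branchFibers k x = placesWithStabilizer H.lineAction.range := by
    ext p
    exact Place.exists_liesOver_branchPlaces_iff H.isCoordinate hE p
  obtain ⟨n, hn, hle, hdvd, hcases⟩ := H.of_range_mulEquiv γ
  have hdeg := hK.natDegree_eq
  intro n'
  have hn' : n' = (n : ℕ∞) := by
    change (Hyperelliptic.branchFibers k x ∩ _).encard = _
    rw [hV]
    exact hn
  rw [hn']
  rw [hdeg] at hle hdvd
  have h0 : (n : ℕ∞) = 0 ↔ n = 0 := by norm_cast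
  have h4 : (n : ℕ∞) = 4 ↔ n = 4 := by norm_cast
  have h8 : (n : ℕ∞) = 8 ↔ n = 8 := by norm_cast
  have h6 : (n : ℕ∞) = 6 ↔ n = 6 := by norm_cast
  have h10 : (n : ℕ∞) = 10 ↔ n = 10 := by norm_cast
  have h14 : (n : ℕ∞) = 14 ↔ n = 14 := by norm_cast
  simp only [h0, h4, h8, h6, h10, h14, Int.ModEq]
  -- The congruences are `2g + 2 ≡ n (mod 12)`; the group is read off from `n` modulo 4.
  refine ⟨fun h => ?_, ?_, ?_, ?_, fun h => ?_, ?_, ?_, ?_⟩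
  · rcases hcases with ⟨-, h1⟩ | ⟨h1, -⟩
    · exact h1
    · omega
  · omega
  · omega
  · omega
  · rcases hcases with ⟨h1, -⟩ | ⟨-, h1⟩
    · omega
    · exact h1
  · omega
  · omega
  · omega
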